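/- Let $(\mathcal A,\phi)$ be a non-commutative probability space, i.e. a von Neumann algebra $\mathcal A$ (acting on a complex Hilbert space) with a state $\phi$. Let $(\eta_n)_{n\ge 1}$ be free standard semicirculars in $\mathcal A$: each $\eta_n$ is self-adjoint with $\phi(\eta_n^k)=\int_{-2}^{2} t^k\,\frac{1}{2\pi}\sqrt{4-t^2}\,dt$ for all $k\ge 0$, and the unital von Neumann algebras generated by the individual $\eta_n$ are free with respect to $\phi$. Write $k_n[\cdot,\dots,\cdot]$ for the free cumulants of $(\mathcal A,\phi)$, determined by the moment–cumulant formula $\phi(a_1\cdots a_n)=\sum_{\pi\in NC(n)}\prod_{V\in\pi}k_{|V|}[a_V]$, where $a_V$ lists the $a_i$, $i\in V$, in increasing order. A process $(X(t))_{t\in T}$ of self-adjoint elements of $\mathcal A$ is a semicircular process if, for all $t_1,\dots,t_m\in T$, all free cumulants of the family $(X(t_1),\dots,X(t_m))$ of order different from $2$ vanish; its covariance is $(s,t)\mapsto\phi(X(s)X(t))$, and it is centred if $\phi(X(t))=0$ for all $t$. All series below are limits of their partial sums in the norm of $\mathcal A$. (1) Let $a<b$, let $K\colon[a,b]^2\to\mathbb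 R$ be a continuous, symmetric, non-negative definite kernel, and let $(f_n)_{n\ge1}$ be an orthonormal basis of the real Hilbert space $L^2[a,b]$ with $\int_a^b K(s,t)f_n(t)\,dt=\lambda_n f_n(s)$ for almost every $s\in[a,b]$, where $\lambda_n\ge 0$ and $f_n$ is continuous on $[a,b]$ whenever $\lambda_n\neq 0$. If the series $$Y(t)=\sum_{n=1}^\infty\sqrt{\lambda_n}\,f_n(t)\,\eta_n$$ converges for every $t\in[a,b]$, then $Y$ is a centred semicircular process on $[a,b]$ with covariance $\phi(Y(s)Y(t))=K(s,t)$. If $\phi$ is faithful on the von Neumann algebra generated by all the $\eta_n$ (in particular, if $\phi$ is faithful), then the series does converge for every $t\in[a,b]$. (2) If the series $$\beta(t)=\sum_{n=1}^\infty\frac{\sqrt2\,\sin(n\pi t)}{n\pi}\,\eta_n$$ converges for every $t\in[0,1]$, then $\beta$ is a free Brownian bridge on $[0,1]$, i.e. a centred semicircular process with covariance $\phi(\beta(s)\beta(t))=\min(s,t)-st$. If $\phi$ is faithful on the von Neumann algebra generated by all the $\eta_n$, then the series does converge for every $t\in[0,1]$. -/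

import Mathlib

open MeasureTheory Filter Topology

noncomputable section

/-! ### Non-commutative probability spaces

A non-commutative probability space is a von Neumann algebra `A` of operators on a complex Hilbert
space together with a state on `A`. The random variables are the elements of
`A.toStarSubalgebra`, which carries the operator norm. -/

section States

variable {R : Type*} [Ring R] [StarRing R] [Algebra ℂ R]

/-- A state: a positive linear functional of total mass one. -/
def IsState (φ : R →ₗ[ℂ] ℂ) : Prop :=
  φ 1 = 1 ∧ ∀ x : R, 0 ≤ (φ (star x * x)).re ∧ (φ (star x * x)).im = 0

/-- The compactly supported measure `μ` on `ℝ` is the distribution of the self-adjoint random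
variable `x`. -/
def HasDistribution (φ : R →ₗ[ℂ] ℂ) (x : R) (μ : Measure ℝ) : Prop :=
  IsSelfAdjoint x ∧ IsProbabilityMeasure μ ∧ (∃ C : Set ℝ, IsCompact C ∧ μ Cᶜ = 0) ∧
    ∀ n : ℕ, φ (x ^ n) = ((∫ t, t ^ n ∂μ : ℝ) : ℂ)

end States

/-- The centred semicircle law of radius `r`. -/
def semicircleLaw (r : ℝ) : Measure ℝ :=
  volume.withDensity fun t =>
    ENNReal.ofReal (Set.indicator (Set.Icc (-r) r)
      (fun t => 2 / (Real.pi * r ^ 2) * √(r ^ 2 - t ^ 2)) t)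

/-- A standard semicircular: its law is the centred semicircle law of radius two. -/
def IsStandardSemicircular {R : Type*} [Ring R] [StarRing R] [Algebra ℂ R]
    (φ : R →ₗ[ℂ] ℂ) (x : R) : Prop :=
  HasDistribution φ x (semicircleLaw 2)

/-! ### Freeness -/

section Freeness

variable {H : Type*} [NormedAddCommGroup H] [InnerProductSpace ℂ H] [CompleteSpace H]

/-- The unital von Neumann algebra generated by a set `S` of operators, that is, the double
commutant of `S ∪ star S` (`StarSubalgebra.centralizer ℂ S` is the commutant of `S ∪ star S`). -/
def generatedVonNeumannAlgebra (S : Set (H →L[ℂ] H)) : VonNeumannAlgebra H where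
  toStarSubalgebra := StarSubalgebra.centralizer ℂ
    (StarSubalgebra.centralizer ℂ S : Set (H →L[ℂ] H))
  centralizer_centralizer' := by simp

/-- The functional `φ` is faithful on the von Neumann algebra generated by the `x i`. -/
def IsFaithfulOnGenerated {A : VonNeumannAlgebra H} (φ : A.toStarSubalgebra →ₗ[ℂ] ℂ) {ι : Type*}
    (x : ι → A.toStarSubalgebra) : Prop :=
  ∀ y : A.toStarSubalgebra,
    (y : H →L[ℂ] H) ∈ generatedVonNeumannAlgebra (Set.range fun i => (x i : H →L[ℂ] H)) →
    φ (star y * y) = 0 → y = 0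

/-- Freeness of a family of von Neumann subalgebras: alternating products of centred elements
are centred. The condition is imposed on nonempty products `x₀ x₁ ⋯ x_m` only. -/
def AreFreeSubalgebras {A : VonNeumannAlgebra H} (φ : A.toStarSubalgebra →ₗ[ℂ] ℂ) {ι : Type*}
    (B : ι → VonNeumannAlgebra H) : Prop :=
  ∀ (m : ℕ) (r : Fin (m + 1) → ι) (x : Fin (m + 1) → A.toStarSubalgebra),
    (∀ j, (x j : H →L[ℂ] H) ∈ B (r j)) →
    (∀ j : Fin m, r j.castSucc ≠ r j.succ) →
    (∀ j, φ (x j) = 0) →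
    φ (List.ofFn x).prod = 0

/-- Random variables are free if the unital von Neumann algebras which they generate are free. -/
def AreFree {A : VonNeumannAlgebra H} (φ : A.toStarSubalgebra →ₗ[ℂ] ℂ) {ι : Type*}
    (x : ι → A.toStarSubalgebra) : Prop :=
  AreFreeSubalgebras φ fun i => generatedVonNeumannAlgebra {(x i : H →L[ℂ] H)}

end Freeness

/-! ### Non-crossing partitions, free cumulants -/

/-- A partition of `{1, …, n}` is non-crossing if there are no distinct blocks `V`, `W` with
`x₁, y₁ ∈ V`, `x₂, y₂ ∈ W` and `x₁ < x₂ < y₁ < y₂`. -/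
def IsNonCrossing {n : ℕ} (π : Finpartition (Finset.univ : Finset (Fin n))) : Prop :=
  ∀ V ∈ π.parts, ∀ W ∈ π.parts, V ≠ W →
    ∀ x₁ ∈ V, ∀ x₂ ∈ W, ∀ y₁ ∈ V, ∀ y₂ ∈ W, ¬ (x₁ < x₂ ∧ x₂ < y₁ ∧ y₁ < y₂)

open Classical in
/-- The free cumulant `k_n[a₁, …, a_n]`, defined recursively by solving the moment-cumulant
formula (proved below) for the term of the one-block partition. -/
def freeCumulant {R : Type*} [Monoid R] (φ : R → ℂ) (n : ℕ) (a : Fin n → R) : ℂ :=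
  φ (List.ofFn a).prod -
    ∑ π : {π : Finpartition (Finset.univ : Finset (Fin n)) //
        IsNonCrossing π ∧ ∀ V ∈ π.parts, V.card < n},
      ∏ V : {V : Finset (Fin n) // V ∈ π.1.parts},
        freeCumulant φ V.1.card (fun i => a (V.1.orderEmbOfFin rfl i))
termination_by n
decreasing_by exact π.2.2 V.1 V.2

/-- The product `k_π[a₁, …, a_n]` of the cumulants of the blocks of `π`. -/
def freeCumulantPartition {R : Type*} [Monoid R] (φ : R → ℂ) {n : ℕ} (a : Fin n → R)
    (π : Finpartition (Finset.univ : Finset (Fin n))) : ℂ :=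
  ∏ V ∈ π.parts, freeCumulant φ V.card (fun i => a (V.orderEmbOfFin rfl i))

open Classical in
/-- The moment-cumulant formula. -/
theorem moment_eq_sum_freeCumulantPartition {R : Type*} [Monoid R] (φ : R → ℂ) (n : ℕ)
    (hn : 1 ≤ n) (a : Fin n → R) :
    φ (List.ofFn a).prod =
      ∑ π : Finpartition (Finset.univ : Finset (Fin n)) with IsNonCrossing π,
        freeCumulantPartition φ a π := by
  have hcard : (Finset.univ : Finset (Fin n)).card = n := by simp
  have hne : (Finset.univ : Finset (Fin n)) ≠ ∅ := by
    intro h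
    rw [h] at hcard
    simp at hcard
    omega
  set top : Finpartition (Finset.univ : Finset (Fin n)) := Finpartition.indiscrete hne with htop
  have htopnc : IsNonCrossing top := by
    intro V hV W hW hVW
    simp [htop] at hV hW
    exact absurd (hV.trans hW.symm) hVW
  have hsmall : ∀ π : Finpartition (Finset.univ : Finset (Fin n)),
      (∀ V ∈ π.parts, V.card < n) ↔ π ≠ top := by
    intro π
    constructor
    · rintro h rfl
      have := h Finset.univ (by simp [htop])
      omega
    · intro h V hV
      by_contra hVn
      have hVu : V = Finset.univ := by
        apply Finset.eq_univ_of_card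
        have := Finset.card_le_univ V
        simp at this ⊢
        omega
      apply h
      apply Finpartition.ext
      simp only [htop, Finpartition.indiscrete_parts]
      apply Finset.eq_singleton_iff_unique_mem.2 ⟨hVu ▸ hV, fun W hW => ?_⟩
      by_contra hW'
      have hd := π.disjoint hV hW (by rintro rfl; exact hW' hVu)
      rw [hVu] at hd
      exact π.ne_bot hW (top_disjoint.1 hd)
  have htopval : freeCumulantPartition φ a top = freeCumulant φ n a := by
    have key : ∀ (m : ℕ) (hm : (Finset.univ : Finset (Fin n)).card = m) (hmn : m = n),
        freeCumulant φ m (fun i => a ((Finset.univ : Finset (Fin n)).orderEmbOfFin hm i)) =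
          freeCumulant φ n a := by
      rintro m hm rfl
      congr 1
      funext i
      congr 1
      have := Finset.orderEmbOfFin_unique' hm (f := RelEmbedding.refl (· ≤ ·))
        (fun x => Finset.mem_univ x)
      rw [← this]
      rfl
    simp only [freeCumulantPartition, htop, Finpartition.indiscrete_parts,
      Finset.prod_singleton]
    exact key _ rfl hcard
  have hrec : freeCumulant φ n a = φ (List.ofFn a).prod -
      ∑ π : Finpartition (Finset.univ : Finset (Fin n)) with IsNonCrossing π ∧ π ≠ top,
        freeCumulantPartition φ a π := by
    rw [freeCumulant]
    congr 1
    rw [Finset.sum_subtype (p := fun π : Finpartition (Finset.univ : Finset (Fin n)) =>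
      IsNonCrossing π ∧ ∀ V ∈ π.parts, V.card < n) _ (by intro π; simp [hsmall])]
    refine Finset.sum_congr rfl fun π _ => ?_
    rw [freeCumulantPartition]
    exact (Finset.prod_subtype (p := fun V => V ∈ π.1.parts) π.1.parts (fun _ => Iff.rfl)
      (fun V => freeCumulant φ V.card (fun i => a (V.orderEmbOfFin rfl i)))).symm
  have hset : (Finset.univ.filter fun π : Finpartition (Finset.univ : Finset (Fin n)) =>
      IsNonCrossing π) = insert top (Finset.univ.filter
        fun π : Finpartition (Finset.univ : Finset (Fin n)) => IsNonCrossing π ∧ π ≠ top) := by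
    ext π
    by_cases h : π = top
    · simp [h, htopnc]
    · simp [h]
  rw [hset, Finset.sum_insert (by simp), htopval, hrec]
  ring

/-! ### Semicircular families and processes -/

section Semicircular

variable {R : Type*} [Ring R] [StarRing R] [Algebra ℂ R]

/-- A semicircular family with covariance `c`: the variables are self-adjoint, the second free
cumulants are given by `c`, and all other free cumulants vanish. -/
def IsSemicircularFamily (φ : R →ₗ[ℂ] ℂ) {ι : Type*} (s : ι → R) (c : ι → ι → ℂ) : Prop :=
  (∀ i, IsSelfAdjoint (s i)) ∧
    (∀ i j, freeCumulant φ 2 ![s i, s j] = c i j) ∧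
    ∀ n : ℕ, 1 ≤ n → n ≠ 2 → ∀ j : Fin n → ι, freeCumulant φ n (fun i => s (j i)) = 0

/-- A semicircular process indexed by `T`: all finite subfamilies are semicircular families. -/
def IsSemicircularProcess (φ : R →ₗ[ℂ] ℂ) {T : Type*} (X : T → R) : Prop :=
  ∀ (n : ℕ) (t : Fin n → T), ∃ c : Fin n → Fin n → ℂ,
    IsSemicircularFamily φ (fun i => X (t i)) c

/-- A centred semicircular process with covariance function `C`. -/
def IsCentredSemicircularProcess (φ : R →ₗ[ℂ] ℂ) {T : Type*} (X : T → R)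
    (C : T → T → ℂ) : Prop :=
  IsSemicircularProcess φ X ∧ (∀ t, φ (X t) = 0) ∧ ∀ s t, φ (X s * X t) = C s t

/-- A free Brownian bridge on `[0, T]`. -/
def IsFreeBrownianBridge (φ : R →ₗ[ℂ] ℂ) (T : ℝ) (β : Set.Icc (0 : ℝ) T → R) : Prop :=
  IsCentredSemicircularProcess φ β
    fun s t => ((min (s : ℝ) t - (s : ℝ) * t / T : ℝ) : ℂ)

end Semicircular

/-! ### Kernels and their eigensystems -/

/-- A continuous symmetric non-negative definite kernel on `[a, b] × [a, b]`. -/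
structure IsMercerKernel (a b : ℝ) (K : ℝ → ℝ → ℝ) : Prop where
  continuousOn : ContinuousOn (Function.uncurry K) (Set.Icc a b ×ˢ Set.Icc a b)
  symm : ∀ s ∈ Set.Icc a b, ∀ t ∈ Set.Icc a b, K s t = K t s
  nonneg : ∀ (n : ℕ) (x : Fin n → ℝ) (c : Fin n → ℝ), (∀ i, x i ∈ Set.Icc a b) →
    0 ≤ ∑ i, ∑ j, c i * c j * K (x i) (x j)

/-- The integral operator `T_K` on functions on `[a, b]`. -/
def kernelOperator (a b : ℝ) (K : ℝ → ℝ → ℝ) (g : ℝ → ℝ) (s : ℝ) : ℝ :=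
  ∫ t in Set.Icc a b, K s t * g t

/-- `(f n)` represents an orthonormal basis of the real Hilbert space `L²[a, b]` consisting of
eigenfunctions of `T_K` with eigenvalues `lam n ≥ 0`; where the eigenvalue does not vanish,
`f n` is the continuous representative of its class. -/
structure IsMercerSystem (a b : ℝ) (K : ℝ → ℝ → ℝ) (lam : ℕ → ℝ) (f : ℕ → ℝ → ℝ) : Prop where
  memLp : ∀ n, MemLp (f n) 2 (volume.restrict (Set.Icc a b))
  orthonormal : Orthonormal ℝ fun n => (memLp n).toLp (f n)
  total : (Submodule.span ℝ (Set.range fun n => (memLp n).toLp (f n))).topologicalClosure = ⊤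
  eigen : ∀ n, kernelOperator a b K (f n) =ᵐ[volume.restrict (Set.Icc a b)]
    fun s => lam n * f n s
  eigenvalue_nonneg : ∀ n, 0 ≤ lam n
  continuousOn : ∀ n, lam n ≠ 0 → ContinuousOn (f n) (Set.Icc a b)

/-! ### Random series -/

/-- The series `∑ c_n(t) η_n` converges in norm, for every `t`, with sum `Y t`. -/
def IsSumOfSeries {R : Type*} [AddCommGroup R] [Module ℂ R] [TopologicalSpace R]
    {T : Type*} (c : ℕ → T → ℝ) (η : ℕ → R) (Y : T → R) : Prop :=
  ∀ t, Tendsto (fun N : ℕ => ∑ n ∈ Finset.range N, ((c n t : ℝ) : ℂ) • η n) atTop (𝓝 (Y t))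

end

/-! Everything rests on one recursion, `SatisfiesSchwingerDyson`: the moment φ(X_t X_{t_1} ⋯
X_{t_m}) is the sum over k of C(t, t_k) times the moment of the factors before t_k times the moment
of those after it. Unfolding it turns every moment into a sum over non-crossing pairings, and
comparison with the moment–cumulant formula, by induction on the order, kills all cumulants of order
other than 2. Since the recursion involves only moments and covariances, it passes to norm limits
(`SatisfiesSchwingerDyson.of_tendsto`).

For finite linear combinations of the η_n the recursion comes from the full Fock space, where right
annihilation operators commute with left field operators up to a vacuum term. Basis words correspond
to alternating products of Chebyshev polynomials S_m(η_i), m ≥ 1. Each factor is centred for the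
semicircle law, so freeness makes the product centred, and the joint moments of the η_n are vacuum
moments of field operators (`satisfiesSchwingerDyson_of_alternating`).

The covariance series must then be summed. For a Mercer kernel, Parseval's identity forces Bessel's
inequality on the diagonal. This gives uniform convergence in one variable, and the L² expansion
identifies the limit (`IsMercerSystem.hasSum`). For the bridge, the Fourier series of the second
Bernoulli polynomial gives the covariance directly.

For norm convergence, the recursion bounds the n-th moment of a combination of variance σ² by
(4σ)^n. A faithful state detects the whole spectrum, so the norm is at most 4σ (`norm_sum_smul_le`),
and square summability of the coefficients suffices. -/

noncomputable section

/-! ### Non-crossing pairings and the Schwinger–Dyson recursion -/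

section Pairings

variable {α : Type*} [LinearOrder α]

/-- `π` is a non-crossing partition of `S` into blocks of size two. -/
structure IsNCPairing (S : Finset α) (π : Finset (Finset α)) : Prop where
  card_eq : ∀ V ∈ π, V.card = 2
  eq_of_mem : ∀ V ∈ π, ∀ W ∈ π, ∀ x, x ∈ V → x ∈ W → V = W
  cover : ∀ x, x ∈ S ↔ ∃ V ∈ π, x ∈ V
  nonCrossing : ∀ V ∈ π, ∀ W ∈ π, V ≠ W →
    ∀ x₁ ∈ V, ∀ x₂ ∈ W, ∀ y₁ ∈ V, ∀ y₂ ∈ W, ¬ (x₁ < x₂ ∧ x₂ < y₁ ∧ y₁ < y₂)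

theorem IsNCPairing.subset {S : Finset α} {π : Finset (Finset α)} (h : IsNCPairing S π)
    {V : Finset α} (hV : V ∈ π) : V ⊆ S := fun x hx => (h.cover x).2 ⟨V, hV, hx⟩

theorem isNCPairing_empty_iff {π : Finset (Finset α)} : IsNCPairing ∅ π ↔ π = ∅ := by
  constructor
  · intro h
    refine Finset.eq_empty_of_forall_notMem fun V hV => ?_
    have := h.card_eq V hV
    rw [Finset.subset_empty.1 (h.subset hV)] at this
    simp at this
  · rintro rfl
    exact ⟨by simp, by simp, by simp, by simp⟩

/-- The block of the least element splits a non-crossing pairing. -/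
theorem IsNCPairing.subset_or_subset {S S₁ S₂ : Finset α} {a b : α}
    (hS : S = insert a (insert b (S₁ ∪ S₂)))
    (ha₁ : ∀ x ∈ S₁, a < x) (hb₁ : ∀ x ∈ S₁, x < b) (hb₂ : ∀ x ∈ S₂, b < x)
    {π : Finset (Finset α)} (h : IsNCPairing S π) (hab : {a, b} ∈ π)
    {V : Finset α} (hV : V ∈ π) (hne : V ≠ {a, b}) : V ⊆ S₁ ∨ V ⊆ S₂ := by
  obtain ⟨x, y, hxy, rfl⟩ := Finset.card_eq_two.1 (h.card_eq V hV)
  have hmem : ∀ z ∈ ({x, y} : Finset α), z ∈ S₁ ∨ z ∈ S₂ := by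
    intro z hz
    have hzS := h.subset hV hz
    have hza : z ≠ a := by
      rintro rfl
      exact hne (h.eq_of_mem _ hV _ hab z hz (by simp))
    have hzb : z ≠ b := by
      rintro rfl
      exact hne (h.eq_of_mem _ hV _ hab z hz (by simp))
    rw [hS] at hzS
    simpa [hza, hzb] using hzS
  -- Otherwise a < u < b < v would be a crossing of {a, b} with V.
  have hcross : ∀ u ∈ ({x, y} : Finset α), ∀ v ∈ ({x, y} : Finset α), u ∈ S₁ → v ∈ S₂ → False :=
    fun u hu v hv hu₁ hv₂ => h.nonCrossing _ hab _ hV hne.symm a (by simp) u hu b (by simp) v hv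
      ⟨ha₁ u hu₁, hb₁ u hu₁, hb₂ v hv₂⟩
  have hx := hmem x (by simp)
  have hy := hmem y (by simp)
  have h1 := hcross x (by simp) y (by simp)
  have h2 := hcross y (by simp) x (by simp)
  simp only [Finset.insert_subset_iff, Finset.singleton_subset_iff]
  tauto

theorem IsNCPairing.filter_subset {S S₁ : Finset α} {π : Finset (Finset α)}
    (h : IsNCPairing S π) (hsub : S₁ ⊆ S)
    (hcov : ∀ V ∈ π, ∀ x ∈ V, x ∈ S₁ → V ⊆ S₁) :
    IsNCPairing S₁ (π.filter (· ⊆ S₁)) where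
  card_eq V hV := h.card_eq V (Finset.mem_filter.1 hV).1
  eq_of_mem V hV W hW := h.eq_of_mem V (Finset.mem_filter.1 hV).1 W (Finset.mem_filter.1 hW).1
  cover x := by
    constructor
    · intro hx
      obtain ⟨V, hV, hxV⟩ := (h.cover x).1 (hsub hx)
      exact ⟨V, Finset.mem_filter.2 ⟨hV, hcov V hV x hxV hx⟩, hxV⟩
    · rintro ⟨V, hV, hxV⟩
      exact (Finset.mem_filter.1 hV).2 hxV
  nonCrossing V hV W hW := h.nonCrossing V (Finset.mem_filter.1 hV).1 W (Finset.mem_filter.1 hW).1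

theorem IsNCPairing.insert_union {S₁ S₂ : Finset α} {a b : α} (hab : a < b)
    (ha₁ : ∀ x ∈ S₁, a < x) (hb₁ : ∀ x ∈ S₁, x < b) (hb₂ : ∀ x ∈ S₂, b < x)
    {π₁ π₂ : Finset (Finset α)} (h₁ : IsNCPairing S₁ π₁) (h₂ : IsNCPairing S₂ π₂) :
    IsNCPairing (insert a (insert b (S₁ ∪ S₂))) (insert {a, b} (π₁ ∪ π₂)) where
  card_eq V hV := by
    simp only [Finset.mem_insert, Finset.mem_union] at hV
    rcases hV with rfl | hV | hV
    · exact Finset.card_pair hab.ne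
    · exact h₁.card_eq V hV
    · exact h₂.card_eq V hV
  eq_of_mem V hV W hW x hxV hxW := by
    simp only [Finset.mem_insert, Finset.mem_union] at hV hW
    have k₁ : ∀ V ∈ π₁, x ∈ V → a < x ∧ x < b := fun V hV hx =>
      ⟨ha₁ x (h₁.subset hV hx), hb₁ x (h₁.subset hV hx)⟩
    have k₂ : ∀ V ∈ π₂, x ∈ V → b < x := fun V hV hx => hb₂ x (h₂.subset hV hx)
    have k₀ : x ∈ ({a, b} : Finset α) → x = a ∨ x = b := by simp
    rcases hV with rfl | hV | hV <;> rcases hW with rfl | hW | hW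
    · rfl
    · have := k₁ W hW hxW; have := k₀ hxV; grind
    · have := k₂ W hW hxW; have := k₀ hxV; grind
    · have := k₁ V hV hxV; have := k₀ hxW; grind
    · exact h₁.eq_of_mem V hV W hW x hxV hxW
    · have := k₁ V hV hxV; have := k₂ W hW hxW; grind
    · have := k₂ V hV hxV; have := k₀ hxW; grind
    · have := k₂ V hV hxV; have := k₁ W hW hxW; grind
    · exact h₂.eq_of_mem V hV W hW x hxV hxW
  cover x := by
    simp only [Finset.mem_insert, Finset.mem_union, h₁.cover x, h₂.cover x]
    constructor
    · rintro (rfl | rfl | ⟨V, hV, hx⟩ | ⟨V, hV, hx⟩)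
      · exact ⟨{x, b}, by simp, by simp⟩
      · exact ⟨{a, x}, by simp, by simp⟩
      · exact ⟨V, by simp [hV], hx⟩
      · exact ⟨V, by simp [hV], hx⟩
    · rintro ⟨V, rfl | hV | hV, hx⟩
      · simp only [Finset.mem_insert, Finset.mem_singleton] at hx
        tauto
      · exact Or.inr (Or.inr (Or.inl ⟨V, hV, hx⟩))
      · exact Or.inr (Or.inr (Or.inr ⟨V, hV, hx⟩))
  nonCrossing V hV W hW hne x₁ hx₁ x₂ hx₂ y₁ hy₁ y₂ hy₂ := by
    simp only [Finset.mem_insert, Finset.mem_union] at hV hW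
    rintro ⟨l₁, l₂, l₃⟩
    have k₁ : ∀ V ∈ π₁, ∀ x ∈ V, a < x ∧ x < b := fun V hV x hx =>
      ⟨ha₁ x (h₁.subset hV hx), hb₁ x (h₁.subset hV hx)⟩
    have k₂ : ∀ V ∈ π₂, ∀ x ∈ V, b < x := fun V hV x hx => hb₂ x (h₂.subset hV hx)
    have k₀ : ∀ x ∈ ({a, b} : Finset α), x = a ∨ x = b := by simp
    rcases hV with rfl | hV | hV <;> rcases hW with rfl | hW | hW
    · exact hne rfl
    · have := k₀ y₁ hy₁; have := k₁ W hW x₂ hx₂; have := k₁ W hW y₂ hy₂; grind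
    · have := k₀ y₁ hy₁; have := k₂ W hW x₂ hx₂; grind
    · have := k₀ x₂ hx₂; have := k₁ V hV x₁ hx₁; have := k₁ V hV y₁ hy₁; grind
    · exact h₁.nonCrossing V hV W hW hne x₁ hx₁ x₂ hx₂ y₁ hy₁ y₂ hy₂ ⟨l₁, l₂, l₃⟩
    · have := k₁ V hV y₁ hy₁; have := k₂ W hW x₂ hx₂; grind
    · have := k₀ x₂ hx₂; have := k₂ V hV x₁ hx₁; grind
    · have := k₂ V hV x₁ hx₁; have := k₁ W hW x₂ hx₂; grind
    · exact h₂.nonCrossing V hV W hW hne x₁ hx₁ x₂ hx₂ y₁ hy₁ y₂ hy₂ ⟨l₁, l₂, l₃⟩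

variable [Fintype α]

open Classical in
/-- The sum over the non-crossing pairings of `S` of the products of the weights of the blocks. -/
def ncPairingSum (w : Finset α → ℂ) (S : Finset α) : ℂ :=
  ∑ π : Finset (Finset α) with IsNCPairing S π, ∏ V ∈ π, w V

theorem ncPairingSum_empty (w : Finset α → ℂ) : ncPairingSum w ∅ = 1 := by
  classical
  simp [ncPairingSum, isNCPairing_empty_iff, Finset.filter_eq']

open Classical in
-- No block can join the inside of {a, b} to the outside, so removing this block gives a bijection
-- with pairs of non-crossing pairings, under which the weights multiply.
theorem sum_isNCPairing_of_mem (w : Finset α → ℂ) {S₁ S₂ : Finset α} {a b : α} (hab : a < b)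
    (ha₁ : ∀ x ∈ S₁, a < x) (hb₁ : ∀ x ∈ S₁, x < b) (hb₂ : ∀ x ∈ S₂, b < x) :
    ∑ π : Finset (Finset α) with
        IsNCPairing (insert a (insert b (S₁ ∪ S₂))) π ∧ {a, b} ∈ π, ∏ V ∈ π, w V =
      w {a, b} * ncPairingSum w S₁ * ncPairingSum w S₂ := by
  have hdisj : ∀ x ∈ S₁, x ∉ S₂ := fun x h h' => lt_asymm (hb₁ x h) (hb₂ x h')
  have hne : ∀ {S : Finset α} {π}, IsNCPairing S π → ∀ V ∈ π, V.Nonempty := fun h V hV =>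
    Finset.card_pos.1 (by rw [h.card_eq V hV]; norm_num)
  have hnot₁ : ¬ ({a, b} : Finset α) ⊆ S₁ := fun h => lt_irrefl _ (ha₁ a (h (by simp)))
  have hnot₂ : ¬ ({a, b} : Finset α) ⊆ S₂ := fun h => lt_irrefl _ (hb₂ b (h (by simp)))
  have hnot₁₂ : ∀ V : Finset α, V.Nonempty → V ⊆ S₁ → ¬ V ⊆ S₂ := by
    rintro V ⟨x, hx⟩ h h'
    exact hdisj x (h hx) (h' hx)
  rw [ncPairingSum, ncPairingSum, mul_assoc, Finset.sum_mul_sum, ← Finset.sum_product',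
    Finset.mul_sum]
  symm
  refine Finset.sum_bij' (fun p _ => insert {a, b} (p.1 ∪ p.2))
    (fun π _ => (π.filter (· ⊆ S₁), π.filter (· ⊆ S₂))) ?_ ?_ ?_ ?_ ?_
  · rintro ⟨π₁, π₂⟩ hp
    simp only [Finset.mem_product, Finset.mem_filter, Finset.mem_univ, true_and] at hp ⊢
    exact ⟨hp.1.insert_union hab ha₁ hb₁ hb₂ hp.2, by simp⟩
  · intro π hπ
    simp only [Finset.mem_product, Finset.mem_filter, Finset.mem_univ, true_and] at hπ ⊢
    obtain ⟨h, habπ⟩ := hπ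
    have hsplit : ∀ V ∈ π, V ≠ {a, b} → V ⊆ S₁ ∨ V ⊆ S₂ := fun V hV hne =>
      h.subset_or_subset rfl ha₁ hb₁ hb₂ habπ hV hne
    constructor
    · refine h.filter_subset (by intro x; simp +contextual) fun V hV x hxV hx => ?_
      have hVne : V ≠ {a, b} := by
        rintro rfl
        have := ha₁ x hx
        have := hb₁ x hx
        simp only [Finset.mem_insert, Finset.mem_singleton] at hxV
        grind
      exact (hsplit V hV hVne).resolve_right fun h' => hdisj x hx (h' hxV)
    · refine h.filter_subset (by intro x; simp +contextual) fun V hV x hxV hx => ?_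
      have hVne : V ≠ {a, b} := by
        rintro rfl
        have := hb₂ x hx
        simp only [Finset.mem_insert, Finset.mem_singleton] at hxV
        grind
      exact (hsplit V hV hVne).resolve_left fun h' => hdisj x (h' hxV) hx
  · rintro ⟨π₁, π₂⟩ hp
    simp only [Finset.mem_product, Finset.mem_filter, Finset.mem_univ, true_and] at hp
    obtain ⟨h₁, h₂⟩ := hp
    ext V
    · simp only [Finset.mem_filter, Finset.mem_insert, Finset.mem_union]
      constructor
      · rintro ⟨rfl | hV | hV, hsub⟩
        · exact absurd hsub hnot₁
        · exact hV
        · exact absurd (h₂.subset hV) (hnot₁₂ V (hne h₂ V hV) hsub)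
      · exact fun hV => ⟨Or.inr (Or.inl hV), h₁.subset hV⟩
    · simp only [Finset.mem_filter, Finset.mem_insert, Finset.mem_union]
      constructor
      · rintro ⟨rfl | hV | hV, hsub⟩
        · exact absurd hsub hnot₂
        · exact absurd hsub (hnot₁₂ V (hne h₁ V hV) (h₁.subset hV))
        · exact hV
      · exact fun hV => ⟨Or.inr (Or.inr hV), h₂.subset hV⟩
  · intro π hπ
    simp only [Finset.mem_filter, Finset.mem_univ, true_and] at hπ
    obtain ⟨h, habπ⟩ := hπ
    ext V
    simp only [Finset.mem_filter, Finset.mem_insert, Finset.mem_union]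
    constructor
    · rintro (rfl | ⟨hV, -⟩ | ⟨hV, -⟩) <;> assumption
    · intro hV
      by_cases hVab : V = {a, b}
      · exact Or.inl hVab
      · have := h.subset_or_subset rfl ha₁ hb₁ hb₂ habπ hV hVab
        tauto
  · rintro ⟨π₁, π₂⟩ hp
    simp only [Finset.mem_product, Finset.mem_filter, Finset.mem_univ, true_and] at hp
    obtain ⟨h₁, h₂⟩ := hp
    rw [Finset.prod_insert, Finset.prod_union]
    · rw [Finset.disjoint_left]
      exact fun V hV hV' => hnot₁₂ V (hne h₁ V hV) (h₁.subset hV) (h₂.subset hV')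
    · rw [Finset.mem_union]
      rintro (hV | hV)
      · exact hnot₁ (h₁.subset hV)
      · exact hnot₂ (h₂.subset hV)

/-- Summation over the partner of the least element. -/
theorem ncPairingSum_cons (w : Finset α → ℂ) {a : α} {l : List α}
    (hl : (a :: l).Pairwise (· < ·)) :
    ncPairingSum w (a :: l).toFinset = ∑ k : Fin l.length, w {a, l[k]} *
      ncPairingSum w (l.take k).toFinset * ncPairingSum w (l.drop (k + 1)).toFinset := by
  classical
  obtain ⟨hal, hl⟩ := List.pairwise_cons.1 hl
  have hnd : l.Nodup := hl.imp ne_of_lt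
  have hterm : ∀ k : Fin l.length, w {a, l[k]} * ncPairingSum w (l.take k).toFinset *
      ncPairingSum w (l.drop (k + 1)).toFinset =
      ∑ π : Finset (Finset α) with IsNCPairing (a :: l).toFinset π ∧ {a, l[k]} ∈ π,
        ∏ V ∈ π, w V := by
    intro k
    have hsplit : l = l.take k ++ l[k] :: l.drop (k + 1) := by
      simp
    have hl' := hl
    rw [hsplit, List.pairwise_append] at hl'
    have hset : (a :: l).toFinset =
        insert a (insert l[k] ((l.take k).toFinset ∪ (l.drop (k + 1)).toFinset)) := by
      rw [List.toFinset_cons]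
      congr 1
      conv_lhs => rw [hsplit]
      ext x
      simp only [List.mem_toFinset, List.mem_append, List.mem_cons, Finset.mem_insert,
        Finset.mem_union]
      tauto
    have key := sum_isNCPairing_of_mem w (a := a) (b := l[k]) (hal _ (List.getElem_mem _))
      (fun x hx => hal x (List.mem_of_mem_take (List.mem_toFinset.1 hx)))
      (fun x hx => hl'.2.2 x (List.mem_toFinset.1 hx) _ List.mem_cons_self)
      (fun x hx => (List.pairwise_cons.1 hl'.2.1).1 x (List.mem_toFinset.1 hx))
    rw [hset, ← key]
  simp_rw [hterm, ncPairingSum]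
  simp_rw [Finset.sum_filter, ite_and]
  -- After the exchange, each pairing is counted once, because the partner of a is unique.
  rw [Finset.sum_comm]
  refine Finset.sum_congr rfl fun π _ => ?_
  split_ifs with h
  · rw [← Finset.sum_filter]
    obtain ⟨V, hV, haV⟩ := (h.cover a).1 (by simp)
    have hVb : ∃ b, b ∈ l ∧ V = {a, b} := by
      obtain ⟨x, y, hxy, rfl⟩ := Finset.card_eq_two.1 (h.card_eq V hV)
      have hx := h.subset hV (Finset.mem_insert_self x _)
      have hy := h.subset hV (Finset.mem_insert_of_mem (Finset.mem_singleton_self y))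
      simp only [List.toFinset_cons, Finset.mem_insert, List.mem_toFinset] at hx hy
      simp only [Finset.mem_insert, Finset.mem_singleton] at haV
      rcases haV with rfl | rfl
      · exact ⟨y, hy.resolve_left hxy.symm, rfl⟩
      · exact ⟨x, hx.resolve_left hxy, Finset.pair_comm _ _⟩
    obtain ⟨b, hb, rfl⟩ := hVb
    obtain ⟨k, hk, rfl⟩ := List.getElem_of_mem hb
    have hf : (Finset.univ.filter fun i : Fin l.length => ({a, l[i]} : Finset α) ∈ π) =
        {⟨k, hk⟩} := by
      ext i
      simp only [Finset.mem_filter, Finset.mem_univ, true_and, Finset.mem_singleton]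
      constructor
      · intro hi
        have := h.eq_of_mem _ hi _ hV a (by simp) (by simp)
        have hmem : l[i] ∈ ({a, l[k]} : Finset α) := by rw [← this]; simp
        simp only [Finset.mem_insert, Finset.mem_singleton] at hmem
        have hne : l[i] ≠ a := (hal _ (List.getElem_mem _)).ne'
        exact Fin.ext ((hnd.getElem_inj_iff).1 (hmem.resolve_left hne))
      · rintro rfl
        exact hV
    rw [hf, Finset.sum_singleton]
  · simp

end Pairings

section SchwingerDyson

/-- The Schwinger–Dyson recursion for the moments of the family `X`. -/
structure SatisfiesSchwingerDyson {R : Type*} [Monoid R] (φ : R → ℂ) {T : Type*} (X : T → R)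
    (C : T → T → ℂ) : Prop where
  map_one : φ 1 = 1
  map_cons : ∀ (t : T) (l : List T), φ ((t :: l).map X).prod =
    ∑ k : Fin l.length, C t l[k] * φ ((l.take k).map X).prod * φ ((l.drop (k + 1)).map X).prod

variable {R : Type*} [Monoid R] {φ : R → ℂ}

/-- Reindexing by positions makes repeated times harmless and supplies the linear order needed for
non-crossing pairings. -/
theorem SatisfiesSchwingerDyson.comp {T T' : Type*} {X : T → R} {C : T → T → ℂ}
    (h : SatisfiesSchwingerDyson φ X C) (j : T' → T) :
    SatisfiesSchwingerDyson φ (fun i => X (j i)) fun s t => C (j s) (j t) := by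
  refine ⟨h.map_one, fun t l => ?_⟩
  have := h.map_cons (j t) (l.map j)
  simp only [← List.map_cons, List.map_map, ← List.map_take, ← List.map_drop] at this
  rw [show (fun i => X (j i)) = X ∘ j from rfl, this]
  exact Fintype.sum_equiv (finCongr (by simp)) _ _ fun k => by simp

theorem SatisfiesSchwingerDyson.map_single {T : Type*} {X : T → R} {C : T → T → ℂ}
    (h : SatisfiesSchwingerDyson φ X C) (t : T) : φ (X t) = 0 := by
  simpa using h.map_cons t []

theorem SatisfiesSchwingerDyson.map_mul {T : Type*} {X : T → R} {C : T → T → ℂ}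
    (h : SatisfiesSchwingerDyson φ X C) (s t : T) : φ (X s * X t) = C s t := by
  simpa [h.map_one] using h.map_cons s [t]

/-- The moments are sums over non-crossing pairings. -/
theorem SatisfiesSchwingerDyson.map_prod_eq_ncPairingSum {α : Type*} [LinearOrder α] [Fintype α]
    {X : α → R} {C : α → α → ℂ} (h : SatisfiesSchwingerDyson φ X C) {w : Finset α → ℂ}
    (hw : ∀ x y, x < y → w {x, y} = C x y) :
    ∀ l : List α, l.Pairwise (· < ·) → φ (l.map X).prod = ncPairingSum w l.toFinset
  | [], _ => by simpa [ncPairingSum_empty] using h.map_one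
  | a :: l, hl => by
    rw [h.map_cons, ncPairingSum_cons w hl]
    obtain ⟨hal, hl⟩ := List.pairwise_cons.1 hl
    refine Finset.sum_congr rfl fun k _ => ?_
    rw [hw a l[k] (hal _ (List.getElem_mem _)),
      map_prod_eq_ncPairingSum h hw (l.take k) (hl.sublist (List.take_sublist _ _)),
      map_prod_eq_ncPairingSum h hw (l.drop (k + 1)) (hl.sublist (List.drop_sublist _ _))]
  termination_by l => l.length

end SchwingerDyson

/-! ### Free cumulants under the Schwinger–Dyson recursion -/

section SchwingerDyson

variable {R : Type*} [Monoid R] {φ : R → ℂ}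

open Classical in
/-- A recursion for the free cumulants, as a sum over partitions. -/
theorem freeCumulant_eq_sub_sum (φ : R → ℂ) (n : ℕ) (a : Fin n → R) :
    freeCumulant φ n a = φ (List.ofFn a).prod -
      ∑ π : Finpartition (Finset.univ : Finset (Fin n)) with
        IsNonCrossing π ∧ ∀ V ∈ π.parts, V.card < n, freeCumulantPartition φ a π := by
  rw [freeCumulant]
  congr 1
  rw [Finset.sum_subtype (p := fun π : Finpartition (Finset.univ : Finset (Fin n)) =>
    IsNonCrossing π ∧ ∀ V ∈ π.parts, V.card < n) _ (by intro π; simp)]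
  refine Finset.sum_congr rfl fun π _ => ?_
  rw [freeCumulantPartition]
  exact (Finset.prod_subtype (p := fun V => V ∈ π.1.parts) π.1.parts (fun _ => Iff.rfl)
    (fun V => freeCumulant φ V.card (fun i => a (V.orderEmbOfFin rfl i)))).symm

theorem card_pos_of_mem_parts {n : ℕ} (π : Finpartition (Finset.univ : Finset (Fin n)))
    {V : Finset (Fin n)} (hV : V ∈ π.parts) : 0 < V.card :=
  Finset.card_pos.2 (π.nonempty_of_mem_parts hV)

theorem exists_mem_parts {n : ℕ} (hn : n ≠ 0)
    (π : Finpartition (Finset.univ : Finset (Fin n))) : ∃ V, V ∈ π.parts := by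
  obtain ⟨V, hV, -⟩ := π.exists_mem (Finset.mem_univ (⟨0, Nat.pos_of_ne_zero hn⟩ : Fin n))
  exact ⟨V, hV⟩

theorem freeCumulant_one (φ : R → ℂ) (a : Fin 1 → R) : freeCumulant φ 1 a = φ (a 0) := by
  classical
  rw [freeCumulant_eq_sub_sum, Finset.sum_eq_zero]
  · simp
  · intro π hπ
    obtain ⟨V, hV⟩ := exists_mem_parts one_ne_zero π
    have h1 := (Finset.mem_filter.1 hπ).2.2 V hV
    have h2 := card_pos_of_mem_parts π hV
    omega

theorem freeCumulant_two (φ : R → ℂ) (a : Fin 2 → R) (ha : φ (a 0) = 0) (ha' : φ (a 1) = 0) :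
    freeCumulant φ 2 a = φ (a 0 * a 1) := by
  classical
  have ha : ∀ i, φ (a i) = 0 := fun i => by fin_cases i <;> assumption
  rw [freeCumulant_eq_sub_sum, Finset.sum_eq_zero]
  · simp
  · intro π hπ
    obtain ⟨V, hV⟩ := exists_mem_parts two_ne_zero π
    refine Finset.prod_eq_zero hV ?_
    have h1 := (Finset.mem_filter.1 hπ).2.2 V hV
    have h2 := card_pos_of_mem_parts π hV
    -- The cardinality is replaced by a variable m because the type of the argument tuple depends on
    -- it.
    have key : ∀ (m : ℕ) (hm : V.card = m), m = 1 →
        freeCumulant φ m (fun i => a (V.orderEmbOfFin hm i)) = 0 := by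
      rintro m hm rfl
      rw [freeCumulant_one, ha]
    exact key _ rfl (by omega)

/-- The parts of a non-crossing partition into pairs form a non-crossing pairing. -/
theorem isNCPairing_parts_iff {n : ℕ} (π : Finpartition (Finset.univ : Finset (Fin n))) :
    IsNCPairing Finset.univ π.parts ↔ IsNonCrossing π ∧ ∀ V ∈ π.parts, V.card = 2 := by
  constructor
  · exact fun h => ⟨h.nonCrossing, h.card_eq⟩
  · rintro ⟨h, h2⟩
    refine ⟨h2, ?_, ?_, h⟩
    · exact fun V hV W hW x hx hx' => π.eq_of_mem_parts hV hW hx hx'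
    · intro x
      simpa using π.exists_mem (Finset.mem_univ x)

theorem IsNCPairing.exists_finpartition {n : ℕ} {P : Finset (Finset (Fin n))}
    (h : IsNCPairing Finset.univ P) :
    ∃ π : Finpartition (Finset.univ : Finset (Fin n)), π.parts = P := by
  refine ⟨⟨P, ?_, ?_, ?_⟩, rfl⟩
  · rw [Finset.supIndep_iff_pairwiseDisjoint]
    intro V hV W hW hne
    simp only [Function.onFun, id]
    rw [Finset.disjoint_left]
    exact fun x hx hx' => hne (h.eq_of_mem V hV W hW x hx hx')
  · ext x
    simpa [Finset.mem_sup] using (h.cover x).1 (Finset.mem_univ x)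
  · intro h0
    simpa using h.card_eq _ h0

open Classical in
theorem ncPairingSum_univ {n : ℕ} (w : Finset (Fin n) → ℂ) :
    ncPairingSum w Finset.univ = ∑ π : Finpartition (Finset.univ : Finset (Fin n)) with
      IsNonCrossing π ∧ ∀ V ∈ π.parts, V.card = 2, ∏ V ∈ π.parts, w V := by
  symm
  rw [ncPairingSum]
  refine Finset.sum_bij (fun π _ => π.parts) ?_ ?_ ?_ ?_
  · intro π hπ
    simpa [isNCPairing_parts_iff] using hπ
  · exact fun π _ π' _ h => Finpartition.ext h
  · intro P hP
    have hP : IsNCPairing Finset.univ P := by simpa using hP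
    obtain ⟨π, rfl⟩ := hP.exists_finpartition
    exact ⟨π, by simpa [isNCPairing_parts_iff] using hP, rfl⟩
  · exact fun _ _ => rfl

theorem freeCumulant_pair {n : ℕ} (a : Fin n → R) {x y : Fin n} (hxy : x < y)
    (ha : ∀ i, φ (a i) = 0) :
    freeCumulant φ ({x, y} : Finset (Fin n)).card
      (fun i => a (({x, y} : Finset (Fin n)).orderEmbOfFin rfl i)) = φ (a x * a y) := by
  have key : ∀ (m : ℕ) (hm : ({x, y} : Finset (Fin n)).card = m), m = 2 →
      freeCumulant φ m (fun i => a (({x, y} : Finset (Fin n)).orderEmbOfFin hm i)) =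
        φ (a x * a y) := by
    rintro m hm rfl
    rw [freeCumulant_two φ _ (ha _) (ha _)]
    have hf := Finset.orderEmbOfFin_unique hm (f := ![x, y]) (by intro i; fin_cases i <;> simp)
      (by
        intro i j hij
        fin_cases i <;> fin_cases j <;> simp_all)
    rw [← hf]
    rfl
  exact key _ rfl (Finset.card_pair hxy.ne)

/-- The Schwinger–Dyson recursion forces all free cumulants of order different from two to
vanish. -/
theorem SatisfiesSchwingerDyson.freeCumulant_eq_zero {T : Type*} {X : T → R} {C : T → T → ℂ}
    (h : SatisfiesSchwingerDyson φ X C) (n : ℕ) (hn : 1 ≤ n) (hn2 : n ≠ 2) (j : Fin n → T) :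
    freeCumulant φ n (fun i => X (j i)) = 0 := by
  classical
  induction n using Nat.strong_induction_on with
  | _ n ih =>
  obtain rfl | hn3 : n = 1 ∨ 3 ≤ n := by omega
  · rw [freeCumulant_one, h.map_single]
  · have hcum : ∀ V : Finset (Fin n), 1 ≤ V.card → V.card < n → V.card ≠ 2 →
        freeCumulant φ V.card (fun i => X (j (V.orderEmbOfFin rfl i))) = 0 :=
      fun V h1 h2 h3 => ih V.card h2 h1 h3 _
    rw [freeCumulant_eq_sub_sum, sub_eq_zero]
    set w : Finset (Fin n) → ℂ :=
      fun V => freeCumulant φ V.card (fun i => X (j (V.orderEmbOfFin rfl i))) with hwdef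
    have hw : ∀ x y, x < y → w {x, y} = C (j x) (j y) := fun x y hxy => by
      rw [hwdef, ← h.map_mul]
      exact freeCumulant_pair (fun i => X (j i)) hxy fun i => h.map_single _
    have hsort : (List.finRange n).Pairwise (· < ·) := List.pairwise_lt_finRange n
    -- The full moment is already the sum over pairings; it remains to match this with the sum over
    -- all partitions into smaller blocks.
    have hm := (h.comp j).map_prod_eq_ncPairingSum hw _ hsort
    rw [List.toFinset_finRange, ncPairingSum_univ, ← List.ofFn_eq_map] at hm
    rw [hm]
    -- Since n ≥ 3, every pairing has only blocks smaller than n. Any other such partition has a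
    -- block of size different from 2, whose cumulant vanishes by induction.
    refine Finset.sum_subset_zero_on_sdiff ?_ ?_ fun _ _ => rfl
    · intro π
      simp only [Finset.mem_filter, Finset.mem_univ, true_and]
      exact fun hπ => ⟨hπ.1, fun V hV => by rw [hπ.2 V hV]; omega⟩
    · intro π hπ
      simp only [Finset.mem_sdiff, Finset.mem_filter, Finset.mem_univ, true_and, not_and,
        not_forall] at hπ
      obtain ⟨⟨hnc, hlt⟩, hex⟩ := hπ
      obtain ⟨V, hV, hV2⟩ := hex hnc
      exact Finset.prod_eq_zero hV (hcum V (card_pos_of_mem_parts π hV) (hlt V hV) hV2)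

end SchwingerDyson

/-! ### From the recursion to semicircular processes -/

section Semicircular

variable {R : Type*} [Ring R] [StarRing R] [Algebra ℂ R]

theorem SatisfiesSchwingerDyson.isCentredSemicircularProcess {φ : R →ₗ[ℂ] ℂ} {T : Type*}
    {X : T → R} {C : T → T → ℂ} (h : SatisfiesSchwingerDyson φ X C)
    (hX : ∀ t, IsSelfAdjoint (X t)) : IsCentredSemicircularProcess φ X C := by
  refine ⟨fun n t => ⟨fun i j => C (t i) (t j), fun i => hX _, fun i j => ?_, ?_⟩,
    h.map_single, h.map_mul⟩
  · rw [freeCumulant_two]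
    · simpa using h.map_mul _ _
    · simpa using h.map_single _
    · simpa using h.map_single _
  · exact fun m hm hm2 j => h.freeCumulant_eq_zero m hm hm2 fun i => t (j i)

end Semicircular

/-! ### Fock space -/

section FockModel

variable {V : Type*} [AddCommGroup V] [Module ℂ V] {T : Type*}

/-- Removing the first argument with the help of right annihilation operators. -/
theorem annihilation_apply_list_prod {Ω : V} {vac : V →ₗ[ℂ] ℂ} {X A : T → Module.End ℂ V}
    {C : T → T → ℂ} (hA : ∀ t, A t Ω = 0)
    (hcomm : ∀ s t v, A s (X t v) = X t (A s v) + (C s t * vac v) • Ω) (s : T) (l : List T) :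
    A s ((l.map X).prod Ω) = ∑ k : Fin l.length,
      (C s l[k] * vac (((l.drop (k + 1)).map X).prod Ω)) • ((l.take k).map X).prod Ω := by
  induction l with
  | nil => simpa using hA s
  | cons t l ih =>
    rw [List.map_cons, List.prod_cons, Module.End.mul_apply, hcomm, ih]
    -- The vacuum term of the commutation relation is the summand k = 0; the other summands are the
    -- induction hypothesis shifted by one.
    simp [Fin.sum_univ_succ, add_comm]

/-- Schwinger–Dyson recursion for the vacuum state. -/
theorem satisfiesSchwingerDyson_vacuum {Ω : V} {vac : V →ₗ[ℂ] ℂ} {X A : T → Module.End ℂ V}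
    {C : T → T → ℂ} (hΩ : vac Ω = 1) (hvac : ∀ t v, vac (X t v) = vac (A t v))
    (hA : ∀ t, A t Ω = 0)
    (hcomm : ∀ s t v, A s (X t v) = X t (A s v) + (C s t * vac v) • Ω) :
    SatisfiesSchwingerDyson (fun P : Module.End ℂ V => vac (P Ω)) X C where
  map_one := by simpa using hΩ
  map_cons t l := by
    rw [List.map_cons, List.prod_cons, Module.End.mul_apply, hvac,
      annihilation_apply_list_prod hA hcomm, map_sum]
    refine Finset.sum_congr rfl fun k _ => ?_
    rw [map_smul, smul_eq_mul]
    ring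

/-- Schwinger–Dyson recursion for linear combinations of orthonormal field operators. -/
theorem satisfiesSchwingerDyson_vacuum_sum {ι : Type*} [DecidableEq ι] {Ω : V} {vac : V →ₗ[ℂ] ℂ}
    {F G : ι → Module.End ℂ V} (hΩ : vac Ω = 1) (hvac : ∀ i v, vac (F i v) = vac (G i v))
    (hG : ∀ i, G i Ω = 0)
    (hcomm : ∀ i j v, G i (F j v) = F j (G i v) + ((if i = j then 1 else 0) * vac v) • Ω)
    (s : Finset ι) (c : ι → T → ℂ) :
    SatisfiesSchwingerDyson (fun P : Module.End ℂ V => vac (P Ω))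
      (fun t => ∑ i ∈ s, c i t • F i) (fun t t' => ∑ i ∈ s, c i t * c i t') := by
  refine satisfiesSchwingerDyson_vacuum (A := fun t => ∑ i ∈ s, c i t • G i) hΩ ?_ ?_ ?_
  · intro t v
    simp [hvac]
  · intro t
    simp [hG]
  · intro t t' v
    simp only [LinearMap.sum_apply, LinearMap.smul_apply, map_sum, map_smul, hcomm, smul_add,
      Finset.sum_add_distrib, Finset.smul_sum]
    congr 1
    · rw [Finset.sum_comm]
      exact Finset.sum_congr rfl fun i _ => Finset.sum_congr rfl fun j _ => smul_comm _ _ _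
    · simp only [smul_smul, ← Finset.sum_smul]
      congr 1
      rw [Finset.sum_mul, Finset.sum_comm]
      refine Finset.sum_congr rfl fun i hi => ?_
      rw [Finset.sum_eq_single i]
      · simp
        ring
      · intro j _ hj
        simp [hj.symm]
      · exact fun h => absurd hi h

theorem SatisfiesSchwingerDyson.of_map_prod_eq {R R' : Type*} [Monoid R] [Monoid R'] {φ : R → ℂ}
    {φ' : R' → ℂ} {X : T → R} {X' : T → R'} {C : T → T → ℂ} (h : SatisfiesSchwingerDyson φ X C)
    (heq : ∀ l : List T, φ' (l.map X').prod = φ (l.map X).prod) :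
    SatisfiesSchwingerDyson φ' X' C where
  map_one := by simpa [h.map_one] using heq []
  map_cons t l := by simp only [heq, h.map_cons]

end FockModel

section FockSpace

variable {ι : Type*} [DecidableEq ι]

/-- Left annihilation of the letter `i` on words. -/
def leftAnnihilate (i : ι) : List ι → (List ι →₀ ℂ)
  | [] => 0
  | j :: w => if i = j then Finsupp.single w 1 else 0

/-- Right annihilation of the letter `i` on words. -/
def rightAnnihilate (i : ι) (w : List ι) : List ι →₀ ℂ :=
  if w.getLast? = some i then Finsupp.single w.dropLast 1 else 0

/-- The sum of the left creation and annihilation operators of the letter `i`. -/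
def fockField (i : ι) : Module.End ℂ (List ι →₀ ℂ) :=
  Finsupp.linearCombination ℂ fun w => Finsupp.single (i :: w) 1 + leftAnnihilate i w

/-- The right annihilation operator of the letter `i`. -/
def fockRightAnnihilation (i : ι) : Module.End ℂ (List ι →₀ ℂ) :=
  Finsupp.linearCombination ℂ (rightAnnihilate i)

/-- The vacuum vector. -/
def fockVacuum : List ι →₀ ℂ := Finsupp.single [] 1

/-- The vacuum coefficient. -/
def fockVacuumCoeff : (List ι →₀ ℂ) →ₗ[ℂ] ℂ := Finsupp.lapply []

@[simp] theorem fockField_single (i : ι) (w : List ι) :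
    fockField i (Finsupp.single w 1) = Finsupp.single (i :: w) 1 + leftAnnihilate i w := by
  simp [fockField]

@[simp] theorem fockRightAnnihilation_single (i : ι) (w : List ι) :
    fockRightAnnihilation i (Finsupp.single w 1) = rightAnnihilate i w := by
  simp [fockRightAnnihilation]

/-- On both sides only the one-letter word i contributes, and there left and right annihilation
coincide. -/
theorem fockVacuumCoeff_fockField (i : ι) (v : List ι →₀ ℂ) :
    fockVacuumCoeff (fockField i v) = fockVacuumCoeff (fockRightAnnihilation i v) := by
  suffices h : fockVacuumCoeff ∘ₗ fockField i = fockVacuumCoeff ∘ₗ fockRightAnnihilation i from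
    LinearMap.congr_fun h v
  refine Finsupp.lhom_ext' fun w => LinearMap.ext_ring ?_
  simp only [LinearMap.comp_apply, Finsupp.lsingle_apply, fockField_single,
    fockRightAnnihilation_single]
  match w with
  | [] => simp [leftAnnihilate, rightAnnihilate, fockVacuumCoeff]
  | [j] =>
    by_cases h : i = j
    · subst h; simp [leftAnnihilate, rightAnnihilate, fockVacuumCoeff]
    · simp [leftAnnihilate, rightAnnihilate, fockVacuumCoeff, h, Ne.symm h]
  | j :: k :: w =>
    simp only [leftAnnihilate, rightAnnihilate, fockVacuumCoeff]
    split_ifs <;> simp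

/-- The two operators act on opposite ends of a word, so they interfere only on the empty word,
where the letter just created on the left is also the last letter. -/
theorem fockRightAnnihilation_fockField (i j : ι) (v : List ι →₀ ℂ) :
    fockRightAnnihilation i (fockField j v) = fockField j (fockRightAnnihilation i v) +
      ((if i = j then 1 else 0) * fockVacuumCoeff v) • fockVacuum := by
  suffices h : fockRightAnnihilation i ∘ₗ fockField j = fockField j ∘ₗ fockRightAnnihilation i +
      (fockVacuumCoeff.smulRight ((if i = j then (1 : ℂ) else 0) • fockVacuum)) by
    have := LinearMap.congr_fun h v
    simpa [smul_smul, mul_comm] using this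
  refine Finsupp.lhom_ext' fun w => LinearMap.ext_ring ?_
  simp only [LinearMap.comp_apply, Finsupp.lsingle_apply, fockField_single,
    fockRightAnnihilation_single, map_add, LinearMap.add_apply, LinearMap.smulRight_apply]
  match w with
  | [] =>
    by_cases h : i = j
    · subst h; simp [leftAnnihilate, rightAnnihilate, fockVacuumCoeff, fockVacuum]
    · simp [leftAnnihilate, rightAnnihilate, fockVacuumCoeff, fockVacuum, h, Ne.symm h]
  | [k] =>
    by_cases h : i = k
    · subst h
      by_cases h' : j = i
      · subst h'; simp [leftAnnihilate, rightAnnihilate, fockVacuumCoeff]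
      · simp [leftAnnihilate, rightAnnihilate, fockVacuumCoeff, h']
    · by_cases h' : j = k
      · subst h'; simp [leftAnnihilate, rightAnnihilate, fockVacuumCoeff, h, Ne.symm h]
      · simp [leftAnnihilate, rightAnnihilate, fockVacuumCoeff, Ne.symm h, h']
  | k :: m :: w =>
    by_cases h : (m :: w).getLast? = some i
    · by_cases h' : j = k
      · subst h'; simp [leftAnnihilate, rightAnnihilate, fockVacuumCoeff, h]
      · simp [leftAnnihilate, rightAnnihilate, fockVacuumCoeff, h, h']
    · by_cases h' : j = k
      · subst h'; simp [leftAnnihilate, rightAnnihilate, fockVacuumCoeff, h]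
      · simp [leftAnnihilate, rightAnnihilate, fockVacuumCoeff, h, h']

theorem fockRightAnnihilation_vacuum (i : ι) : fockRightAnnihilation i fockVacuum = 0 := by
  simp [fockVacuum, rightAnnihilate]

/-- Schwinger–Dyson recursion for linear combinations of the field operators. -/
theorem satisfiesSchwingerDyson_fockField {T : Type*} (s : Finset ι) (c : ι → T → ℂ) :
    SatisfiesSchwingerDyson (fun P : Module.End ℂ (List ι →₀ ℂ) => fockVacuumCoeff (P fockVacuum))
      (fun t => ∑ i ∈ s, c i t • fockField i) (fun t t' => ∑ i ∈ s, c i t * c i t') :=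
  satisfiesSchwingerDyson_vacuum_sum (by simp [fockVacuumCoeff, fockVacuum])
    fockVacuumCoeff_fockField fockRightAnnihilation_vacuum fockRightAnnihilation_fockField s c

end FockSpace

/-! ### Free families with vanishing Chebyshev moments -/

section FreeFamily

variable {R : Type*} [Ring R] [Algebra ℂ R] {ι : Type*} [DecidableEq ι]

/-- The image of a word of the Fock space in an algebra containing the variables `x i`. -/
def fockWord (x : ι → R) : List ι → R
  | [] => 1
  | [i] => x i
  | i :: j :: w => x i * fockWord x (j :: w) - if i = j then fockWord x w else 0

/-- The linear extension of `fockWord`. -/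
def fockMap (x : ι → R) : (List ι →₀ ℂ) →ₗ[ℂ] R := Finsupp.linearCombination ℂ (fockWord x)

/-- The subtraction in `fockWord` is chosen to cancel the annihilation part of the field operator,
so that the field acts as left multiplication. -/
theorem fockMap_fockField (x : ι → R) (i : ι) (v : List ι →₀ ℂ) :
    fockMap x (fockField i v) = x i * fockMap x v := by
  suffices h : fockMap x ∘ₗ fockField i = LinearMap.mulLeft ℂ (x i) ∘ₗ fockMap x from
    LinearMap.congr_fun h v
  refine Finsupp.lhom_ext' fun w => LinearMap.ext_ring ?_
  simp only [LinearMap.comp_apply, Finsupp.lsingle_apply, fockField_single, map_add,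
    LinearMap.mulLeft_apply]
  match w with
  | [] => simp [fockMap, leftAnnihilate, fockWord]
  | j :: w =>
    simp only [fockMap, leftAnnihilate]
    split_ifs with h <;> simp [fockWord, h]

open Polynomial in
/-- The words of the Fock space are alternating products of Chebyshev polynomials. -/
theorem exists_fockWord_eq (x : ι → R) (w : List ι) (i : ι) :
    ∃ (n : ℕ) (L : List (ι × R)),
      (∀ p ∈ L, ∃ m : ℕ, p.2 = aeval (x p.1) (Chebyshev.S ℂ (m + 1))) ∧
      (L.IsChain fun p q => p.1 ≠ q.1) ∧ (∀ p ∈ L.head?, i ≠ p.1) ∧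
      fockWord x w = aeval (x i) (Chebyshev.S ℂ n) * (L.map Prod.snd).prod ∧
      fockWord x (i :: w) = aeval (x i) (Chebyshev.S ℂ (n + 1)) * (L.map Prod.snd).prod := by
  -- Here n is the length of the initial run of i in w, possibly 0, and L lists the remaining runs.
  -- Both w and i :: w are tracked because the Chebyshev recursion has three terms.
  induction w generalizing i with
  | nil => exact ⟨0, [], by simp, by simp, by simp, by simp [fockWord], by simp [fockWord]⟩
  | cons j w ih =>
    by_cases hij : i = j
    · subst hij
      obtain ⟨n, L, h1, h2, h3, h4, h5⟩ := ih i
      refine ⟨n + 1, L, h1, h2, h3, by simpa using h5, ?_⟩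
      rw [fockWord, if_pos rfl, h4, h5]
      have := Chebyshev.S_add_two ℂ (n : ℤ)
      rw [show ((n + 1 : ℕ) : ℤ) + 1 = (n : ℤ) + 2 by push_cast; ring, this]
      simp [sub_mul, mul_assoc]
    · obtain ⟨n, L, h1, h2, h3, h4, h5⟩ := ih j
      refine ⟨0, (j, aeval (x j) (Chebyshev.S ℂ (n + 1))) :: L, ?_, ?_, ?_, ?_, ?_⟩
      · intro p hp
        rcases List.mem_cons.1 hp with rfl | hp
        · exact ⟨n, rfl⟩
        · exact h1 p hp
      · rw [List.isChain_cons]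
        exact ⟨fun q hq => h3 q hq, h2⟩
      · simpa using hij
      · simpa using h5
      · simp [fockWord, hij, h5]

/-- Linear combinations of variables `x i`, for which alternating products of Chebyshev
polynomials in the `x i` are centred, satisfy the Schwinger–Dyson recursion. -/
theorem satisfiesSchwingerDyson_of_alternating {φ : R →ₗ[ℂ] ℂ} (h1 : φ 1 = 1) (x : ι → R)
    (halt : ∀ L : List (ι × R), L ≠ [] → (L.IsChain fun p q => p.1 ≠ q.1) →
      (∀ p ∈ L, ∃ m : ℕ, p.2 = Polynomial.aeval (x p.1) (Polynomial.Chebyshev.S ℂ (m + 1))) →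
      φ (L.map Prod.snd).prod = 0)
    {T : Type*} (s : Finset ι) (c : ι → T → ℂ) :
    SatisfiesSchwingerDyson φ (fun t => ∑ i ∈ s, c i t • x i)
      (fun t t' => ∑ i ∈ s, c i t * c i t') := by
  refine (satisfiesSchwingerDyson_fockField s c).of_map_prod_eq fun l => ?_
  -- Every nonempty word is sent to an alternating product of Chebyshev polynomials of positive
  -- degree, on which φ vanishes.
  have hvac : φ ∘ₗ fockMap x = fockVacuumCoeff := by
    refine Finsupp.lhom_ext' fun w => LinearMap.ext_ring ?_
    match w with
    | [] => simp [fockMap, fockWord, fockVacuumCoeff, h1]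
    | i :: w =>
      obtain ⟨n, L, hL, hc, hh, -, h5⟩ := exists_fockWord_eq x w i
      have := halt ((i, Polynomial.aeval (x i) (Polynomial.Chebyshev.S ℂ (n + 1))) :: L)
        (by simp) (by rw [List.isChain_cons]; exact ⟨fun q hq => hh q hq, hc⟩) (by
          intro p hp
          rcases List.mem_cons.1 hp with rfl | hp
          · exact ⟨n, rfl⟩
          · exact hL p hp)
      simpa [fockMap, fockVacuumCoeff, h5] using this
  rw [← hvac, LinearMap.comp_apply]
  congr 1
  induction l with
  | nil => simp [fockMap, fockVacuum, fockWord]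
  | cons t l ih =>
    rw [List.map_cons, List.prod_cons, ih, List.map_cons, List.prod_cons, Module.End.mul_apply]
    simp [fockMap_fockField, Finset.sum_mul]

end FreeFamily

/-! ### Chebyshev polynomials under the semicircle law -/

theorem integral_semicircleLaw_two (f : ℝ → ℝ) :
    ∫ t, f t ∂(semicircleLaw 2) =
      ∫ t in (-2 : ℝ)..2, f t * (2 / (Real.pi * 2 ^ 2) * √(2 ^ 2 - t ^ 2)) := by
  have hmeas : Measurable (Set.indicator (Set.Icc (-2 : ℝ) 2)
      fun t => 2 / (Real.pi * 2 ^ 2) * √(2 ^ 2 - t ^ 2)) :=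
    (by fun_prop : Measurable fun t : ℝ => 2 / (Real.pi * 2 ^ 2) * √(2 ^ 2 - t ^ 2)).indicator
      measurableSet_Icc
  rw [semicircleLaw, integral_withDensity_eq_integral_toReal_smul hmeas.ennreal_ofReal (by simp),
    intervalIntegral.integral_of_le (by norm_num), ← integral_Icc_eq_integral_Ioc,
    ← integral_indicator measurableSet_Icc]
  refine integral_congr_ae (Eventually.of_forall fun t => ?_)
  by_cases ht : t ∈ Set.Icc (-2 : ℝ) 2
  · simp only [Set.indicator_of_mem ht, smul_eq_mul]
    rw [ENNReal.toReal_ofReal (by positivity), mul_comm]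
  · simp [Set.indicator_of_notMem ht]

theorem integral_sin_mul_sin_eq_zero (n : ℕ) :
    ∫ θ in (0 : ℝ)..Real.pi, Real.sin ((n + 2 : ℝ) * θ) * Real.sin θ = 0 := by
  have h : ∀ θ : ℝ, Real.sin ((n + 2 : ℝ) * θ) * Real.sin θ =
      1 / 2 * (Real.cos ((n + 1 : ℝ) * θ) - Real.cos ((n + 3 : ℝ) * θ)) := by
    intro θ
    rw [show (n + 1 : ℝ) * θ = (n + 2 : ℝ) * θ - θ by ring,
      show (n + 3 : ℝ) * θ = (n + 2 : ℝ) * θ + θ by ring, Real.cos_sub, Real.cos_add]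
    ring
  have hz : ∀ m : ℕ, ∫ θ in (0 : ℝ)..Real.pi, Real.cos ((m + 1 : ℝ) * θ) = 0 := by
    intro m
    rw [intervalIntegral.integral_comp_mul_left _ (by positivity), integral_cos]
    have := Real.sin_nat_mul_pi (m + 1)
    push_cast at this
    simp [this]
  simp_rw [h]
  rw [intervalIntegral.integral_const_mul, intervalIntegral.integral_sub
    (by apply Continuous.intervalIntegrable; fun_prop)
    (by apply Continuous.intervalIntegrable; fun_prop), hz n]
  have := hz (n + 2)
  push_cast at this
  rw [show (n + 2 + 1 : ℝ) = n + 3 by ring] at this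
  simp [this]

open Polynomial in
/-- The Chebyshev polynomials of the second kind are centred for the semicircle law. -/
theorem integral_chebyshevS_semicircleLaw (n : ℕ) :
    ∫ t, (Chebyshev.S ℝ (n + 1)).eval t ∂(semicircleLaw 2) = 0 := by
  rw [integral_semicircleLaw_two]
  -- Substituting t = 2 cos θ turns S_{n+1}(t) sin θ into sin((n+2)θ). The factor -2/π below
  -- collects the density constant 1/(2π), a 2 from the root and a -2 from the differential.
  have hsub := intervalIntegral.integral_comp_mul_deriv (a := Real.pi) (b := 0)
    (f := fun θ => 2 * Real.cos θ) (f' := fun θ => 2 * -Real.sin θ)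
    (g := fun t => (Chebyshev.S ℝ (n + 1)).eval t * (2 / (Real.pi * 2 ^ 2) * √(2 ^ 2 - t ^ 2)))
    (fun θ _ => (Real.hasDerivAt_cos θ).const_mul 2) (by fun_prop)
    (((Chebyshev.S ℝ (n + 1)).continuous).mul (by fun_prop))
  simp only [Real.cos_pi, Real.cos_zero, mul_neg, mul_one] at hsub
  rw [← hsub, intervalIntegral.integral_symm, neg_eq_zero]
  refine (intervalIntegral.integral_congr
    (g := fun θ => -2 / Real.pi * (Real.sin ((n + 2 : ℝ) * θ) * Real.sin θ))
    fun θ hθ => ?_).trans (by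
      rw [intervalIntegral.integral_const_mul, integral_sin_mul_sin_eq_zero, mul_zero])
  rw [Set.uIcc_of_le Real.pi_pos.le] at hθ
  have hs := Real.sin_nonneg_of_mem_Icc hθ
  have hroot : √(2 ^ 2 - (2 * Real.cos θ) ^ 2) = 2 * Real.sin θ := by
    rw [← Real.sqrt_sq (by positivity : 0 ≤ 2 * Real.sin θ)]
    congr 1
    nlinarith [Real.sin_sq_add_cos_sq θ]
  have hS := Chebyshev.S_two_mul_real_cos θ (n + 1)
  push_cast at hS
  rw [show (n + 1 + 1 : ℝ) = n + 2 by ring] at hS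
  simp only [Function.comp_apply, hroot, ← hS]
  field_simp

/-- Compact support makes every polynomial integrable, so the moment identities may be added. -/
theorem map_aeval_eq_integral {R : Type*} [Ring R] [StarRing R] [Algebra ℂ R] {φ : R →ₗ[ℂ] ℂ}
    {x : R} {μ : Measure ℝ} (h : HasDistribution φ x μ) (p : Polynomial ℝ) :
    φ (Polynomial.aeval x (p.map (algebraMap ℝ ℂ))) = ((∫ t, p.eval t ∂μ : ℝ) : ℂ) := by
  obtain ⟨-, hprob, ⟨K, hK, hμK⟩, hmom⟩ := h
  have hint : ∀ q : Polynomial ℝ, Integrable (fun t => q.eval t) μ := by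
    intro q
    have hr : μ.restrict K = μ := Measure.restrict_eq_self_of_ae_mem hμK
    rw [← hr]
    exact q.continuous.continuousOn.integrableOn_compact hK
  induction p using Polynomial.induction_on' with
  | add p q hp hq =>
    simp only [Polynomial.map_add, map_add, hp, hq, Polynomial.eval_add]
    rw [integral_add (hint p) (hint q)]
    push_cast
    rfl
  | monomial n a =>
    simp [Polynomial.aeval_monomial, ← Algebra.smul_def, hmom, integral_const_mul]

theorem map_aeval_chebyshevS {R : Type*} [Ring R] [StarRing R] [Algebra ℂ R] {φ : R →ₗ[ℂ] ℂ}
    {x : R} (h : IsStandardSemicircular φ x) (n : ℕ) :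
    φ (Polynomial.aeval x (Polynomial.Chebyshev.S ℂ (n + 1))) = 0 := by
  rw [← Polynomial.Chebyshev.map_S (algebraMap ℝ ℂ), map_aeval_eq_integral h,
    integral_chebyshevS_semicircleLaw]
  simp

/-! ### Freeness and generated von Neumann algebras -/

section

variable {H : Type*} [NormedAddCommGroup H] [InnerProductSpace ℂ H] [CompleteSpace H]

theorem AreFreeSubalgebras.map_list_prod {A : VonNeumannAlgebra H} {φ : A.toStarSubalgebra →ₗ[ℂ] ℂ}
    {ι : Type*} {B : ι → VonNeumannAlgebra H} (h : AreFreeSubalgebras φ B)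
    (L : List (ι × A.toStarSubalgebra)) (hL : L ≠ []) (hc : L.IsChain fun p q => p.1 ≠ q.1)
    (hB : ∀ p ∈ L, (p.2 : H →L[ℂ] H) ∈ B p.1) (h0 : ∀ p ∈ L, φ p.2 = 0) :
    φ (L.map Prod.snd).prod = 0 := by
  obtain ⟨m, hm⟩ := Nat.exists_eq_succ_of_ne_zero (List.length_pos_iff.2 hL).ne'
  have hlt : ∀ j : Fin (m + 1), (j : ℕ) < L.length := fun j => by omega
  have := h m (fun j => (L[(j : ℕ)]'(hlt j)).1) (fun j => (L[(j : ℕ)]'(hlt j)).2)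
    (fun j => hB _ (List.getElem_mem _))
    (fun j => (List.isChain_iff_getElem.1 hc) j (by omega))
    (fun j => h0 _ (List.getElem_mem _))
  convert this using 3
  refine List.ext_getElem (by simp [hm]) fun i h1 h2 => by
    simp only [List.getElem_map, List.getElem_ofFn]

/-- The commutant is closed under adjoints, so commuting with each z already covers the condition on
`star z`. -/
theorem mem_generatedVonNeumannAlgebra_iff {S : Set (H →L[ℂ] H)} {x : H →L[ℂ] H} :
    x ∈ generatedVonNeumannAlgebra S ↔
      ∀ z ∈ StarSubalgebra.centralizer ℂ S, z * x = x * z := by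
  change x ∈ StarSubalgebra.centralizer ℂ (StarSubalgebra.centralizer ℂ S : Set (H →L[ℂ] H)) ↔ _
  rw [StarSubalgebra.mem_centralizer_iff]
  constructor
  · exact fun h z hz => (h z hz).1
  · exact fun h z hz => ⟨h z hz, h _ (star_mem hz)⟩

theorem subset_generatedVonNeumannAlgebra {S : Set (H →L[ℂ] H)} {x : H →L[ℂ] H} (hx : x ∈ S) :
    x ∈ generatedVonNeumannAlgebra S :=
  mem_generatedVonNeumannAlgebra_iff.2 fun _ hz =>
    ((StarSubalgebra.mem_centralizer_iff ℂ).1 hz x hx).1.symm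

theorem aeval_mem_generatedVonNeumannAlgebra {A : VonNeumannAlgebra H} (x : A.toStarSubalgebra)
    (p : Polynomial ℂ) : ((Polynomial.aeval x p : A.toStarSubalgebra) : H →L[ℂ] H) ∈
      generatedVonNeumannAlgebra {(x : H →L[ℂ] H)} := by
  have hmem : (Polynomial.aeval (x : H →L[ℂ] H) p) ∈
      (generatedVonNeumannAlgebra {(x : H →L[ℂ] H)}).toStarSubalgebra.toSubalgebra := by
    rw [Polynomial.aeval_eq_sum_range]
    exact sum_mem fun i _ => Subalgebra.smul_mem _
      (pow_mem (show (x : H →L[ℂ] H) ∈ (generatedVonNeumannAlgebra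
        {(x : H →L[ℂ] H)}).toStarSubalgebra.toSubalgebra from
          subset_generatedVonNeumannAlgebra rfl) i) _
  have := Polynomial.aeval_algHom_apply A.toStarSubalgebra.subtype.toAlgHom x p
  change _ = ((Polynomial.aeval x p : A.toStarSubalgebra) : H →L[ℂ] H) at this
  rw [← this]
  exact hmem

end

/-! ### Moment bounds -/

section MomentBounds

theorem catalan_le_catalan_succ (n : ℕ) : catalan n ≤ catalan (n + 1) := by
  rw [catalan_succ]
  have := Finset.single_le_sum (f := fun i : Fin n.succ => catalan i * catalan (n - i))
    (fun _ _ => Nat.zero_le _) (Finset.mem_univ (0 : Fin n.succ))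
  simpa using this

theorem catalan_le_four_pow (n : ℕ) : catalan n ≤ 4 ^ n := by
  rw [catalan_eq_centralBinom_div]
  refine (Nat.div_le_self _ _).trans ?_
  rw [Nat.centralBinom_eq_two_mul_choose]
  refine (Nat.choose_le_two_pow _ _).trans ?_
  rw [pow_mul]
  norm_num

variable {R : Type*} [Monoid R] {φ : R → ℂ} {T : Type*} {X : T → R} {C : T → T → ℂ}

theorem SatisfiesSchwingerDyson.map_pow_succ (h : SatisfiesSchwingerDyson φ X C) (t : T) (n : ℕ) :
    φ (X t ^ (n + 1)) = ∑ k : Fin n, C t t * φ (X t ^ (k : ℕ)) * φ (X t ^ (n - (k + 1))) := by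
  have := h.map_cons t (List.replicate n t)
  rw [← List.replicate_succ, List.map_replicate, List.prod_replicate] at this
  rw [this]
  refine Fintype.sum_equiv (finCongr (by simp)) _ _ fun k => ?_
  have hk : (k : ℕ) < n := by simpa using k.2
  simp [List.take_replicate, List.drop_replicate, min_eq_left hk.le]

theorem SatisfiesSchwingerDyson.norm_map_pow_le (h : SatisfiesSchwingerDyson φ X C) {t : T}
    {σ : ℝ} (hσ : 0 ≤ σ) (hC : ‖C t t‖ ≤ σ ^ 2) (n : ℕ) :
    ‖φ (X t ^ n)‖ ≤ (4 * σ) ^ n := by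
  -- The Catalan number of n, rather than of n/2, is wasteful but avoids a case split on parity;
  -- monotonicity absorbs the shift of index.
  have key : ‖φ (X t ^ n)‖ ≤ σ ^ n * catalan n := by
    induction n using Nat.strong_induction_on with
    | _ n ih =>
    match n with
    | 0 => simp [h.map_one]
    | 1 => simpa [h.map_single] using hσ
    | n + 2 =>
      rw [h.map_pow_succ]
      calc ‖∑ k : Fin (n + 1), C t t * φ (X t ^ (k : ℕ)) * φ (X t ^ (n + 1 - (k + 1)))‖
          ≤ ∑ k : Fin (n + 1), σ ^ 2 * (σ ^ (k : ℕ) * catalan k) *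
              (σ ^ (n - k) * catalan (n - k)) := by
            refine (norm_sum_le _ _).trans (Finset.sum_le_sum fun k _ => ?_)
            rw [norm_mul, norm_mul, Nat.add_sub_add_right]
            have h1 := ih k (by omega)
            have h2 := ih (n - k) (by omega)
            gcongr
        _ = σ ^ (n + 2) * catalan (n + 1) := by
            rw [catalan_succ]
            push_cast
            rw [Finset.mul_sum]
            refine Finset.sum_congr rfl fun k _ => ?_
            have : σ ^ (n + 2) = σ ^ 2 * (σ ^ (k : ℕ) * σ ^ (n - k)) := by
              rw [← pow_add, ← pow_add]
              congr 1
              omega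
            rw [this]
            ring
        _ ≤ σ ^ (n + 2) * catalan (n + 2) := by
            gcongr
            exact catalan_le_catalan_succ _
  calc ‖φ (X t ^ n)‖ ≤ σ ^ n * catalan n := key
    _ ≤ σ ^ n * 4 ^ n := by
        gcongr
        exact_mod_cast catalan_le_four_pow n
    _ = (4 * σ) ^ n := by rw [mul_pow, mul_comm]

end MomentBounds

/-! ### States on `C⋆`-algebras -/

section CStar

variable {R : Type*} [CStarAlgebra R] {φ : R →ₗ[ℂ] ℂ}

open scoped ComplexOrder in
-- Nonnegative elements have the form `star y * y`, so a state is positive for the spectral order,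
-- and positive functionals on a C⋆-algebra are bounded.
theorem IsState.continuous (h : IsState φ) : Continuous φ := by
  let _ := CStarAlgebra.spectralOrder R
  have := CStarAlgebra.spectralOrderedRing R
  have hpos : ∀ x : R, 0 ≤ x → 0 ≤ φ x := by
    intro x hx
    obtain ⟨y, rfl⟩ := CStarAlgebra.nonneg_iff_eq_star_mul_self.mp hx
    exact Complex.nonneg_iff.2 ⟨(h.2 y).1, (h.2 y).2.symm⟩
  exact map_continuous (PositiveLinearMap.mk₀ φ hpos)

theorem IsState.re_map_cfc_nonneg (h : IsState φ) {x : R} (g : ℝ → ℝ)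
    (hg : Continuous g) (hpos : ∀ t ∈ spectrum ℝ x, 0 ≤ g t) : 0 ≤ (φ (cfc g x)).re := by
  have : cfc g x = star (cfc (fun t => √(g t)) x) * cfc (fun t => √(g t)) x := by
    rw [← cfc_star, ← cfc_mul _ _ x (by fun_prop) (by fun_prop)]
    refine cfc_congr fun t ht => ?_
    simp [Real.mul_self_sqrt (hpos t ht)]
  rw [this]
  exact (h.2 _).1

/-- If the state is faithful on the functional calculus of `x`, then the growth of the moments of
`x` controls its norm. -/
theorem IsState.norm_le_of_norm_map_pow_le (h : IsState φ) {x : R} (hx : IsSelfAdjoint x)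
    (hfaith : ∀ f : ℝ → ℝ, Continuous f → φ (star (cfc f x) * cfc f x) = 0 → cfc f x = 0)
    {r : ℝ} (hr : 0 ≤ r) (hmom : ∀ n, ‖φ (x ^ n)‖ ≤ r ^ n) : ‖x‖ ≤ r := by
  have : Nontrivial R := by
    by_contra hn
    rw [not_nontrivial_iff_subsingleton] at hn
    have := h.1
    rw [Subsingleton.elim (1 : R) 0, map_zero] at this
    exact zero_ne_one this
  -- The strict inequality s > r makes (r/s)^(2k) tend to 0.
  refine le_of_forall_gt_imp_ge_of_dense fun s hs => ?_
  have hs0 : 0 < s := hr.trans_lt hs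
  -- This f vanishes exactly on [-s, s], so f(x) = 0 confines the spectrum of x to that interval.
  set f : ℝ → ℝ := fun t => max (|t| - s) 0 with hf
  have hfc : Continuous f := by fun_prop
  have hsq : star (cfc f x) * cfc f x = cfc (fun t => f t ^ 2) x := by
    rw [← cfc_star, ← cfc_mul _ _ x (by fun_prop) (by fun_prop)]
    refine cfc_congr fun t _ => ?_
    simp [sq]
  have hspec : ∀ t ∈ spectrum ℝ x, |t| ≤ ‖x‖ := fun t ht => by
    simpa using spectrum.norm_le_norm_of_mem ht
  -- On the spectrum f(t)² ≤ ‖x‖² (t/s)^(2k): f is 0 for |t| ≤ s, and beyond that the power is at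
  -- least 1. Applying φ brings in the moment bound.
  have hbound : ∀ k : ℕ, (φ (cfc (fun t => f t ^ 2) x)).re ≤ ‖x‖ ^ 2 * ((r / s) ^ 2) ^ k := by
    intro k
    have h1 : cfc (fun t => ‖x‖ ^ 2 / s ^ (2 * k) * t ^ (2 * k) - f t ^ 2) x =
        ((‖x‖ ^ 2 / s ^ (2 * k) : ℝ) : ℂ) • x ^ (2 * k) - cfc (fun t => f t ^ 2) x := by
      rw [cfc_sub _ _ x (by fun_prop) (by fun_prop), cfc_const_mul _ _ x (by fun_prop),
        cfc_pow_id x _, Complex.coe_smul]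
    have h2 := h.re_map_cfc_nonneg (x := x)
      (fun t => ‖x‖ ^ 2 / s ^ (2 * k) * t ^ (2 * k) - f t ^ 2) (by fun_prop) ?_
    · rw [h1, map_sub, map_smul, Complex.sub_re, sub_nonneg, smul_eq_mul,
        Complex.re_ofReal_mul] at h2
      refine h2.trans ?_
      have h3 : (φ (x ^ (2 * k))).re ≤ r ^ (2 * k) :=
        (Complex.re_le_norm _).trans (hmom _)
      calc ‖x‖ ^ 2 / s ^ (2 * k) * (φ (x ^ (2 * k))).re
          ≤ ‖x‖ ^ 2 / s ^ (2 * k) * r ^ (2 * k) := by gcongr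
        _ = ‖x‖ ^ 2 * ((r / s) ^ 2) ^ k := by
            rw [← pow_mul, div_pow]
            ring
    · intro t ht
      rw [sub_nonneg]
      rcases le_total |t| s with hts | hts
      · have : f t = 0 := by simp [hf, hts]
        rw [this, pow_mul t, zero_pow two_ne_zero]
        positivity
      · have h0 : 0 ≤ f t := le_max_right _ _
        have h1 : f t ≤ ‖x‖ := max_le ((by linarith [hspec t ht])) (norm_nonneg _)
        have h2 : 1 ≤ (|t| / s) ^ (2 * k) := one_le_pow₀ ((one_le_div hs0).2 hts)
        calc f t ^ 2 ≤ ‖x‖ ^ 2 * 1 := by rw [mul_one]; gcongr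
          _ ≤ ‖x‖ ^ 2 * (|t| / s) ^ (2 * k) := by gcongr
          _ = ‖x‖ ^ 2 / s ^ (2 * k) * t ^ (2 * k) := by
            rw [div_pow, pow_mul |t|, sq_abs, ← pow_mul]
            ring
  have hlim : Tendsto (fun k : ℕ => ‖x‖ ^ 2 * ((r / s) ^ 2) ^ k) atTop (𝓝 (‖x‖ ^ 2 * 0)) :=
    (tendsto_pow_atTop_nhds_zero_of_lt_one (by positivity)
      (pow_lt_one₀ (by positivity) ((div_lt_one hs0).2 hs) two_ne_zero)).const_mul _
  rw [mul_zero] at hlim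
  have hle := ge_of_tendsto' hlim hbound
  have hst := h.2 (cfc f x)
  rw [hsq] at hst
  have hzero : cfc f x = 0 := hfaith f hfc (by
    rw [hsq]
    exact Complex.ext (le_antisymm hle hst.1) hst.2)
  rw [← cfc_id ℝ x]
  refine norm_cfc_le hs0.le fun t ht => ?_
  have hft : f t ∈ spectrum ℝ (cfc f x) := by
    rw [cfc_map_spectrum f x]
    exact ⟨t, ht, rfl⟩
  rw [hzero] at hft
  rw [spectrum.zero_eq, Set.mem_singleton_iff] at hft
  have := le_max_left (|t| - s) 0
  simp only [id, Real.norm_eq_abs]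
  linarith [this.trans_eq hft]

end CStar

/-! ### Series of free semicirculars -/

section Series

variable {H : Type*} [NormedAddCommGroup H] [InnerProductSpace ℂ H] [CompleteSpace H]

/-- The algebra is its own double commutant, and commutants are norm closed. -/
theorem VonNeumannAlgebra.isClosed (A : VonNeumannAlgebra H) :
    IsClosed (A.toStarSubalgebra : Set (H →L[ℂ] H)) := by
  rw [VonNeumannAlgebra.coe_toStarSubalgebra, ← A.centralizer_centralizer]
  exact Set.isClosed_centralizer _

/-- The `C⋆`-algebra underlying a von Neumann algebra. -/
@[reducible] def VonNeumannAlgebra.cstarAlgebra (A : VonNeumannAlgebra H) :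
    CStarAlgebra A.toStarSubalgebra :=
  StarSubalgebra.cstarAlgebra A.toStarSubalgebra (h_closed := A.isClosed)

variable {A : VonNeumannAlgebra H} {φ : A.toStarSubalgebra →ₗ[ℂ] ℂ}

theorem IsState.continuous_vonNeumann (hφ : IsState φ) : Continuous φ := by
  let _ := A.cstarAlgebra
  exact IsState.continuous (R := A.toStarSubalgebra) hφ

theorem cfc_mem_generatedVonNeumannAlgebra {S : Set (H →L[ℂ] H)} {x : A.toStarSubalgebra}
    (hxS : (x : H →L[ℂ] H) ∈ generatedVonNeumannAlgebra S) (hx : IsSelfAdjoint x) {f : ℝ → ℝ}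
    (hf : Continuous f) :
    letI := A.cstarAlgebra
    ((cfc f x : A.toStarSubalgebra) : H →L[ℂ] H) ∈ generatedVonNeumannAlgebra S := by
  let _ := A.cstarAlgebra
  -- The inclusion is a continuous ⋆-homomorphism, so the functional calculus may be computed among
  -- all operators, where it commutes with whatever commutes with x.
  have hmap : ((cfc f x : A.toStarSubalgebra) : H →L[ℂ] H) = cfc f (x : H →L[ℂ] H) :=
    StarAlgHomClass.map_cfc A.toStarSubalgebra.subtype f x hf.continuousOn
      continuous_subtype_val hx (hx.map A.toStarSubalgebra.subtype)
  rw [hmap, mem_generatedVonNeumannAlgebra_iff]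
  rw [mem_generatedVonNeumannAlgebra_iff] at hxS
  intro z hz
  have hcomm : Commute (x : H →L[ℂ] H) z := (hxS z hz).symm
  exact (hcomm.cfc_real f).symm

theorem satisfiesSchwingerDyson_of_areFree (hφ : IsState φ) {η : ℕ → A.toStarSubalgebra}
    (hη : ∀ n, IsStandardSemicircular φ (η n)) (hfree : AreFree φ η) {T : Type*} (s : Finset ℕ)
    (c : ℕ → T → ℂ) :
    SatisfiesSchwingerDyson φ (fun t => ∑ i ∈ s, c i t • η i)
      (fun t t' => ∑ i ∈ s, c i t * c i t') := by
  refine satisfiesSchwingerDyson_of_alternating hφ.1 η (fun L hL hc hm => ?_) s c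
  refine AreFreeSubalgebras.map_list_prod hfree L hL hc (fun p hp => ?_) fun p hp => ?_
  · obtain ⟨m, hm⟩ := hm p hp
    rw [hm]
    exact aeval_mem_generatedVonNeumannAlgebra _ _
  · obtain ⟨m, hm⟩ := hm p hp
    rw [hm]
    exact map_aeval_chebyshevS (hη _) m

theorem isSelfAdjoint_sum_smul {R : Type*} [Ring R] [StarRing R] [Algebra ℂ R] [StarModule ℂ R]
    {η : ℕ → R} (hη : ∀ n, IsSelfAdjoint (η n)) (s : Finset ℕ) (c : ℕ → ℝ) :
    IsSelfAdjoint (∑ i ∈ s, ((c i : ℝ) : ℂ) • η i) :=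
  isSelfAdjoint_sum _ fun i _ => IsSelfAdjoint.smul (Complex.conj_ofReal _) (hη i)

/-- The moments grow at most like (4σ)^n with σ² the sum of the squared coefficients, and
faithfulness turns this growth into a norm bound. For convergence any fixed constant in place of 4
would do. -/
theorem norm_sum_smul_le (hφ : IsState φ) {η : ℕ → A.toStarSubalgebra}
    (hη : ∀ n, IsStandardSemicircular φ (η n)) (hfree : AreFree φ η)
    (hfaith : IsFaithfulOnGenerated φ η) (s : Finset ℕ) (c : ℕ → ℝ) :
    ‖∑ i ∈ s, ((c i : ℝ) : ℂ) • η i‖ ≤ 4 * √(∑ i ∈ s, c i ^ 2) := by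
  let _ := A.cstarAlgebra
  set x := ∑ i ∈ s, ((c i : ℝ) : ℂ) • η i with hx
  have hsa : IsSelfAdjoint x := isSelfAdjoint_sum_smul (fun n => (hη n).1) s c
  have hSD := satisfiesSchwingerDyson_of_areFree hφ hη hfree (T := Unit) s
    (fun i _ => ((c i : ℝ) : ℂ))
  have hgen : (x : H →L[ℂ] H) ∈
      generatedVonNeumannAlgebra (Set.range fun i => (η i : H →L[ℂ] H)) := by
    have : x ∈ (generatedVonNeumannAlgebra (Set.range fun i =>
        (η i : H →L[ℂ] H))).toStarSubalgebra.toSubalgebra.comap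
          A.toStarSubalgebra.subtype.toAlgHom := by
      refine sum_mem fun i _ => Subalgebra.smul_mem _ ?_ _
      exact subset_generatedVonNeumannAlgebra ⟨i, rfl⟩
    exact this
  refine IsState.norm_le_of_norm_map_pow_le (R := A.toStarSubalgebra) hφ hsa ?_ (by positivity) ?_
  · intro f hf h0
    exact hfaith _ (cfc_mem_generatedVonNeumannAlgebra hgen hsa hf) h0
  · intro n
    refine hSD.norm_map_pow_le (t := ()) (Real.sqrt_nonneg _) (le_of_eq ?_) n
    rw [Real.sq_sqrt (Finset.sum_nonneg fun _ _ => sq_nonneg _)]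
    have : ∑ i ∈ s, ((c i : ℝ) : ℂ) * ((c i : ℝ) : ℂ) = ((∑ i ∈ s, c i ^ 2 : ℝ) : ℂ) := by
      push_cast
      exact Finset.sum_congr rfl fun i _ => by ring
    rw [this, Complex.norm_real, Real.norm_of_nonneg (Finset.sum_nonneg fun _ _ => sq_nonneg _)]

/-- Limits of families satisfying the Schwinger–Dyson recursion. -/
theorem SatisfiesSchwingerDyson.of_tendsto {R : Type*} [Monoid R] [TopologicalSpace R]
    [ContinuousMul R] {φ : R → ℂ} (hφ : Continuous φ) {T : Type*} {X : ℕ → T → R}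
    {C : ℕ → T → T → ℂ} {Y : T → R} {D : T → T → ℂ}
    (h : ∀ N, SatisfiesSchwingerDyson φ (X N) (C N))
    (hX : ∀ t, Tendsto (fun N => X N t) atTop (𝓝 (Y t)))
    (hC : ∀ s t, Tendsto (fun N => C N s t) atTop (𝓝 (D s t))) :
    SatisfiesSchwingerDyson φ Y D where
  map_one := (h 0).map_one
  map_cons t l := by
    have hlim : ∀ l : List T, Tendsto (fun N => φ (l.map (X N)).prod) atTop
        (𝓝 (φ (l.map Y).prod)) := fun l =>
      (hφ.tendsto _).comp (tendsto_list_prod l fun i _ => hX i)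
    refine tendsto_nhds_unique (hlim (t :: l)) ?_
    simp_rw [fun N => (h N).map_cons t l]
    exact tendsto_finsetSum _ fun k _ => ((hC _ _).mul (hlim _)).mul (hlim _)

/-- The sum of a series of free semicirculars is a centred semicircular process. -/
theorem IsSumOfSeries.isCentredSemicircularProcess (hφ : IsState φ) {η : ℕ → A.toStarSubalgebra}
    (hη : ∀ n, IsStandardSemicircular φ (η n)) (hfree : AreFree φ η) {T : Type*}
    {c : ℕ → T → ℝ} {Y : T → A.toStarSubalgebra} (hY : IsSumOfSeries c η Y) {K : T → T → ℝ}
    (hK : ∀ s t, HasSum (fun n => c n s * c n t) (K s t)) :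
    IsCentredSemicircularProcess φ Y fun s t => ((K s t : ℝ) : ℂ) := by
  refine SatisfiesSchwingerDyson.isCentredSemicircularProcess
    (SatisfiesSchwingerDyson.of_tendsto hφ.continuous_vonNeumann
      (fun N => satisfiesSchwingerDyson_of_areFree hφ hη hfree (Finset.range N)
        fun n t => ((c n t : ℝ) : ℂ)) hY fun s t => ?_) fun t => ?_
  · have := (Complex.continuous_ofReal.tendsto _).comp (hK s t).tendsto_sum_nat
    refine this.congr fun N => ?_
    simp
  · have hcl : IsClosed {x : A.toStarSubalgebra | IsSelfAdjoint x} :=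
      isClosed_eq continuous_star continuous_id
    exact hcl.mem_of_tendsto (hY t) (Eventually.of_forall fun N =>
      isSelfAdjoint_sum_smul (fun n => (hη n).1) _ _)

/-- Under faithfulness, a series of free semicirculars with square summable coefficients
converges. -/
theorem exists_isSumOfSeries (hφ : IsState φ) {η : ℕ → A.toStarSubalgebra}
    (hη : ∀ n, IsStandardSemicircular φ (η n)) (hfree : AreFree φ η)
    (hfaith : IsFaithfulOnGenerated φ η) {T : Type*} {c : ℕ → T → ℝ}
    (hc : ∀ t, Summable fun n => c n t ^ 2) :
    ∃ Y : T → A.toStarSubalgebra, IsSumOfSeries c η Y := by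
  have hcomplete : CompleteSpace A.toStarSubalgebra := A.isClosed.completeSpace_coe
  have key : ∀ t, Summable fun n => ((c n t : ℝ) : ℂ) • η n := by
    intro t
    rw [summable_iff_vanishing_norm]
    intro ε hε
    -- The threshold is chosen so that 4 times its square root is ε.
    obtain ⟨s, hs⟩ := (summable_iff_vanishing_norm.1 (hc t)) ((ε / 4) ^ 2) (by positivity)
    refine ⟨s, fun u hu => ?_⟩
    have h1 := hs u hu
    rw [Real.norm_of_nonneg (Finset.sum_nonneg fun _ _ => sq_nonneg _)] at h1
    have h2 := norm_sum_smul_le hφ hη hfree hfaith u fun n => c n t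
    have h3 := (Real.sqrt_lt' (by positivity)).2 h1
    linarith
  exact ⟨fun t => ∑' n, ((c n t : ℝ) : ℂ) • η n, fun t => (key t).hasSum.tendsto_sum_nat⟩

end Series

/-! ### The covariance of the Brownian bridge -/

theorem hasSum_cos_div_sq {x : ℝ} (hx : x ∈ Set.Icc (0 : ℝ) 1) :
    HasSum (fun n : ℕ => Real.cos (2 * Real.pi * (n + 1 : ℝ) * x) / (n + 1 : ℝ) ^ 2)
      (Real.pi ^ 2 * (x ^ 2 - x + 1 / 6)) := by
  have h := hasSum_one_div_nat_pow_mul_cos one_ne_zero hx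
  -- The term n = 0 can be dropped: division by zero makes it 0.
  have h2 := (hasSum_nat_add_iff' 1).2 h
  convert! h2 using 1
  · funext n
    push_cast
    ring
  · simp [Polynomial.bernoulli, Finset.sum_range_succ, bernoulli_two, Nat.factorial]
    ring

/-- By 2 sin x sin y = cos(x - y) - cos(x + y), this is a difference of two cosine series, taken at
(t - s)/2 and (t + s)/2. Ordering s ≤ t keeps both points in [0, 1]. -/
theorem hasSum_sin_mul_sin {s t : ℝ} (hs : s ∈ Set.Icc (0 : ℝ) 1) (ht : t ∈ Set.Icc (0 : ℝ) 1) :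
    HasSum (fun n : ℕ => √2 * Real.sin ((n + 1 : ℝ) * Real.pi * s) / ((n + 1 : ℝ) * Real.pi) *
      (√2 * Real.sin ((n + 1 : ℝ) * Real.pi * t) / ((n + 1 : ℝ) * Real.pi)))
      (min s t - s * t) := by
  wlog hst : s ≤ t generalizing s t
  · have := this ht hs (le_of_not_ge hst)
    rw [min_comm, mul_comm t s] at this
    exact (by simpa only [mul_comm] using this)
  obtain ⟨hs0, hs1⟩ := hs
  obtain ⟨ht0, ht1⟩ := ht
  have h1 := hasSum_cos_div_sq (x := (t - s) / 2) ⟨by linarith, by linarith⟩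
  have h2 := hasSum_cos_div_sq (x := (t + s) / 2) ⟨by linarith, by linarith⟩
  convert! (h1.sub h2).mul_left (1 / Real.pi ^ 2) using 1
  · funext n
    rw [show 2 * Real.pi * (n + 1 : ℝ) * ((t - s) / 2) =
        (n + 1 : ℝ) * Real.pi * t - (n + 1 : ℝ) * Real.pi * s by ring,
      show 2 * Real.pi * (n + 1 : ℝ) * ((t + s) / 2) =
        (n + 1 : ℝ) * Real.pi * t + (n + 1 : ℝ) * Real.pi * s by ring, Real.cos_sub, Real.cos_add]
    have h0 : (n + 1 : ℝ) ≠ 0 := by positivity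
    have h2 : √2 * √2 = 2 := Real.mul_self_sqrt (by norm_num)
    generalize Real.sin ((n + 1 : ℝ) * Real.pi * s) = x
    generalize Real.sin ((n + 1 : ℝ) * Real.pi * t) = y
    field_simp
    linear_combination x * y * h2
  · rw [min_eq_left hst]
    field_simp
    ring

/-! ### Mercer's expansion -/

section Mercer

variable {α : Type*} [MeasurableSpace α] {μ : Measure α}

theorem inner_toLp_eq_integral {u v : α → ℝ} (hu : MemLp u 2 μ) (hv : MemLp v 2 μ) :
    inner ℝ (hu.toLp u) (hv.toLp v) = ∫ x, u x * v x ∂μ := by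
  rw [L2.inner_def]
  refine integral_congr_ae ?_
  filter_upwards [hu.coeFn_toLp, hv.coeFn_toLp] with x h1 h2
  rw [h1, h2]
  simp [mul_comm]

theorem coeFn_sum_smul_toLp {f : ℕ → α → ℝ} (hf : ∀ n, MemLp (f n) 2 μ) (c : ℕ → ℝ)
    (s : Finset ℕ) :
    ⇑(∑ n ∈ s, c n • (hf n).toLp (f n)) =ᵐ[μ] fun x => ∑ n ∈ s, c n * f n x := by
  induction s using Finset.induction_on with
  | empty =>
    simp only [Finset.sum_empty]
    exact Lp.coeFn_zero _ _ _
  | insert n s hn ih =>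
    simp only [Finset.sum_insert hn]
    filter_upwards [Lp.coeFn_add (c n • (hf n).toLp (f n)) (∑ n ∈ s, c n • (hf n).toLp (f n)), ih,
      Lp.coeFn_smul (c n) ((hf n).toLp (f n)), (hf n).coeFn_toLp] with x h1 h2 h3 h4
    rw [h1, Pi.add_apply, h2, h3, Pi.smul_apply, h4, smul_eq_mul]

/-- Parseval's identity. -/
theorem hasSum_integral_mul_integral {f : ℕ → α → ℝ} (hf : ∀ n, MemLp (f n) 2 μ)
    (hon : Orthonormal ℝ fun n => (hf n).toLp (f n))
    (htot : (Submodule.span ℝ (Set.range fun n => (hf n).toLp (f n))).topologicalClosure = ⊤)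
    {u v : α → ℝ} (hu : MemLp u 2 μ) (hv : MemLp v 2 μ) :
    HasSum (fun n => (∫ x, u x * f n x ∂μ) * ∫ x, f n x * v x ∂μ) (∫ x, u x * v x ∂μ) := by
  have := (HilbertBasis.mk hon htot.ge).hasSum_inner_mul_inner (hu.toLp u) (hv.toLp v)
  simpa only [HilbertBasis.coe_mk, inner_toLp_eq_integral] using this

theorem hasSum_integral_smul {f : ℕ → α → ℝ} (hf : ∀ n, MemLp (f n) 2 μ)
    (hon : Orthonormal ℝ fun n => (hf n).toLp (f n))
    (htot : (Submodule.span ℝ (Set.range fun n => (hf n).toLp (f n))).topologicalClosure = ⊤)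
    {u : α → ℝ} (hu : MemLp u 2 μ) :
    HasSum (fun n => (∫ x, f n x * u x ∂μ) • (hf n).toLp (f n)) (hu.toLp u) := by
  have := (HilbertBasis.mk hon htot.ge).hasSum_repr (hu.toLp u)
  simpa only [HilbertBasis.repr_apply_apply, HilbertBasis.coe_mk, inner_toLp_eq_integral] using this

variable {a b M : ℝ} {K : ℝ → ℝ → ℝ} {lam : ℕ → ℝ} {f : ℕ → ℝ → ℝ}

theorem continuous_kernelOperator (hK : Continuous (Function.uncurry K))
    (hM : ∀ s t, |K s t| ≤ M) {g : ℝ → ℝ} (hg : IntegrableOn g (Set.Icc a b)) :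
    Continuous (kernelOperator a b K g) := by
  unfold kernelOperator
  refine continuous_of_dominated (bound := fun t => M * ‖g t‖) ?_ ?_ ?_ ?_
  · intro s
    exact ((by fun_prop : Continuous fun t => K s t).aestronglyMeasurable).mul
      hg.aestronglyMeasurable
  · intro s
    refine Eventually.of_forall fun t => ?_
    rw [norm_mul]
    gcongr
    exact hM s t
  · exact hg.norm.const_mul _
  · refine Eventually.of_forall fun t => ?_
    fun_prop

theorem IsMercerSystem.integrableOn (h : IsMercerSystem a b K lam f) (n : ℕ) :
    IntegrableOn (f n) (Set.Icc a b) :=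
  (h.memLp n).integrable one_le_two

/-- The eigenvalue equation holds everywhere. -/
theorem IsMercerSystem.kernelOperator_eq (h : IsMercerSystem a b K lam f) (hab : a < b)
    (hK : Continuous (Function.uncurry K)) (hM : ∀ s t, |K s t| ≤ M) (n : ℕ) {s : ℝ}
    (hs : s ∈ Set.Icc a b) : kernelOperator a b K (f n) s = lam n * f n s := by
  refine Measure.eqOn_Icc_of_ae_eq volume hab.ne (h.eigen n)
    (continuous_kernelOperator hK hM (h.integrableOn n)).continuousOn ?_ hs
  -- Where the eigenvalue vanishes f n need not be continuous, but its product with the eigenvalue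
  -- is zero.
  by_cases hl : lam n = 0
  · simpa [hl] using continuousOn_const
  · exact continuousOn_const.mul (h.continuousOn n hl)

/-- Parseval's identity for the quadratic form of the kernel at an indicator function. -/
theorem IsMercerSystem.hasSum_sq_integral (h : IsMercerSystem a b K lam f) (hab : a < b)
    (hK : Continuous (Function.uncurry K)) (hM : ∀ s t, |K s t| ≤ M)
    (hsymm : ∀ s t, K s t = K t s) {J : Set ℝ} (hJ : MeasurableSet J) (hJs : J ⊆ Set.Icc a b) :
    HasSum (fun n => lam n * (∫ t in J, f n t) ^ 2) (∫ s in J, ∫ t in J, K s t) := by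
  have hrestr : (volume.restrict (Set.Icc a b)).restrict J = volume.restrict J := by
    rw [Measure.restrict_restrict hJ, Set.inter_eq_left.2 hJs]
  have hfin : IsFiniteMeasure (volume.restrict J) :=
    ⟨by
      rw [Measure.restrict_apply_univ]
      exact (measure_mono hJs).trans_lt measure_Icc_lt_top⟩
  have hu : MemLp (J.indicator fun _ => (1 : ℝ)) 2 (volume.restrict (Set.Icc a b)) :=
    memLp_indicator_const 2 hJ 1 (Or.inr (measure_ne_top _ _))
  have hwc : Continuous fun s => ∫ t in J, K s t := by
    refine continuous_of_dominated (bound := fun _ => M) ?_ ?_ (integrable_const _) ?_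
    · exact fun s => (by fun_prop : Continuous fun t => K s t).aestronglyMeasurable
    · exact fun s => Eventually.of_forall fun t => hM s t
    · exact Eventually.of_forall fun t => by fun_prop
  have hw : MemLp (fun s => ∫ t in J, K s t) 2 (volume.restrict (Set.Icc a b)) := by
    obtain ⟨B, hB⟩ := isCompact_Icc.exists_bound_of_continuousOn (s := Set.Icc a b)
      hwc.continuousOn
    exact MemLp.of_bound hwc.aestronglyMeasurable B
      ((ae_restrict_iff' measurableSet_Icc).2 (Eventually.of_forall hB))
  have hind : ∀ g : ℝ → ℝ, ∫ s in Set.Icc a b, g s * J.indicator (fun _ => (1 : ℝ)) s =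
      ∫ s in J, g s := by
    intro g
    rw [← hrestr, ← integral_indicator hJ]
    refine integral_congr_ae (Eventually.of_forall fun s => ?_)
    by_cases hs : s ∈ J <;> simp [hs]
  -- Parseval for ∫_J K(·, t) dt against the indicator of J. Fubini and the eigenvalue equation then
  -- evaluate the first coefficient.
  have hmain := hasSum_integral_mul_integral h.memLp h.orthonormal h.total hw hu
  simp only [hind] at hmain
  convert hmain using 1
  funext n
  have hfub : ∫ s in Set.Icc a b, (∫ t in J, K s t) * f n s =
      ∫ t in J, ∫ s in Set.Icc a b, K s t * f n s := by
    simp_rw [← integral_mul_const]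
    refine integral_integral_swap ?_
    have h1 : Integrable (fun p : ℝ × ℝ => f n p.1 * (1 : ℝ))
        ((volume.restrict (Set.Icc a b)).prod (volume.restrict J)) :=
      (h.integrableOn n).mul_prod (integrable_const 1)
    simp only [mul_one] at h1
    exact h1.bdd_mul (c := M) hK.aestronglyMeasurable (Eventually.of_forall fun p => hM p.1 p.2)
  have heig : ∫ t in J, ∫ s in Set.Icc a b, K s t * f n s = ∫ t in J, lam n * f n t := by
    refine setIntegral_congr_fun hJ fun t ht => ?_
    rw [← h.kernelOperator_eq hab hK hM n (hJs ht)]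
    simp only [kernelOperator, hsymm t]
  rw [hfub, heig, integral_const_mul]
  ring

/-- Bessel's inequality on the diagonal. -/
theorem IsMercerSystem.sum_sq_le (h : IsMercerSystem a b K lam f) (hab : a < b)
    (hK : Continuous (Function.uncurry K)) (hM : ∀ s t, |K s t| ≤ M)
    (hsymm : ∀ s t, K s t = K t s) (u : Finset ℕ) {t : ℝ} (ht : t ∈ Set.Icc a b) :
    ∑ n ∈ u, lam n * f n t ^ 2 ≤ K t t := by
  by_contra! hlt
  -- If D is positive at (t, t), it is bounded below by a positive constant on a small square J × J.
  -- But its integral there is at most 0, as a partial sum of a nonnegative series minus the full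
  -- sum.
  set D : ℝ × ℝ → ℝ := fun p => (∑ n ∈ u, lam n * (f n p.1 * f n p.2)) - K p.1 p.2 with hD
  have hDc : ContinuousOn D (Set.Icc a b ×ˢ Set.Icc a b) := by
    refine ContinuousOn.sub (continuousOn_finsetSum _ fun n _ => ?_) hK.continuousOn
    by_cases hl : lam n = 0
    · simpa [hl] using continuousOn_const
    · have hf := h.continuousOn n hl
      exact continuousOn_const.mul ((hf.comp continuousOn_fst fun p hp => hp.1).mul
        (hf.comp continuousOn_snd fun p hp => hp.2))
  have hDt : 0 < D (t, t) := by
    simp only [hD, sub_pos]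
    simpa only [← sq] using hlt
  obtain ⟨δ, hδ, hball⟩ := Metric.continuousOn_iff.1 hDc (t, t) ⟨ht, ht⟩ (D (t, t) / 2)
    (by positivity)
  -- Clipping to [a, b] lets t be an endpoint; the length stays positive because a < b.
  set J := Set.Icc (max a (t - δ / 2)) (min b (t + δ / 2)) with hJdef
  have hJs : J ⊆ Set.Icc a b := Set.Icc_subset_Icc (le_max_left _ _) (min_le_left _ _)
  have hlen : max a (t - δ / 2) < min b (t + δ / 2) := by
    rw [max_lt_iff, lt_min_iff, lt_min_iff]
    refine ⟨⟨hab, ?_⟩, ?_, ?_⟩ <;> linarith [ht.1, ht.2]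
  have hJt : ∀ x ∈ J, dist x t < δ := by
    intro x hx
    rw [Real.dist_eq, abs_lt]
    constructor
    · linarith [(le_max_right a (t - δ / 2)).trans hx.1]
    · linarith [hx.2.trans (min_le_right b (t + δ / 2))]
  have hDlow : ∀ x ∈ J, ∀ y ∈ J, D (t, t) / 2 ≤ D (x, y) := by
    intro x hx y hy
    have := hball (x, y) ⟨hJs hx, hJs hy⟩ (max_lt (hJt x hx) (hJt y hy))
    rw [Real.dist_eq, abs_lt] at this
    linarith [this.1]
  have hJfin : volume J ≠ ⊤ := measure_Icc_lt_top.ne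
  have hJpos : 0 < (volume J).toReal := by
    rw [hJdef, Real.volume_Icc, ENNReal.toReal_ofReal (by linarith)]
    linarith
  have hfJ : ∀ n, IntegrableOn (f n) J := fun n => (h.integrableOn n).mono_set hJs
  have hKJ : ∀ s, IntegrableOn (fun t => K s t) J := fun s =>
    (by fun_prop : Continuous fun t => K s t).integrableOn_Icc
  have hinner : ∀ x, ∫ y in J, D (x, y) =
      (∑ n ∈ u, lam n * f n x * ∫ y in J, f n y) - ∫ y in J, K x y := by
    intro x
    simp only [hD, ← mul_assoc]
    rw [integral_sub (integrable_finsetSum _ fun n _ => (hfJ n).const_mul _) (hKJ x),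
      integral_finsetSum _ fun n _ => (hfJ n).const_mul _]
    simp only [integral_const_mul]
  have hKint : IntegrableOn (fun x => ∫ y in J, K x y) J := by
    have hfin : IsFiniteMeasure (volume.restrict J) := ⟨by
      rw [Measure.restrict_apply_univ]; exact hJfin.lt_top⟩
    refine Continuous.integrableOn_Icc (continuous_of_dominated (bound := fun _ => M)
      ?_ ?_ (integrable_const _) ?_)
    · exact fun s => (by fun_prop : Continuous fun t => K s t).aestronglyMeasurable
    · exact fun s => Eventually.of_forall fun t => hM s t
    · exact Eventually.of_forall fun t => by fun_prop
  have hsumint : ∀ n ∈ u, IntegrableOn (fun x => lam n * f n x * ∫ y in J, f n y) J :=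
    fun n _ => ((hfJ n).const_mul _).mul_const _
  have houter : ∫ x in J, ∫ y in J, D (x, y) =
      (∑ n ∈ u, lam n * (∫ y in J, f n y) ^ 2) - ∫ x in J, ∫ y in J, K x y := by
    simp only [hinner]
    rw [integral_sub (integrable_finsetSum _ hsumint) hKint, integral_finsetSum _ hsumint]
    simp only [integral_mul_const, integral_const_mul]
    congr 1
    exact Finset.sum_congr rfl fun n _ => by ring
  have hle : ∫ x in J, ∫ y in J, D (x, y) ≤ 0 := by
    rw [houter, sub_nonpos]
    exact sum_le_hasSum _ (fun n _ => mul_nonneg (h.eigenvalue_nonneg n) (sq_nonneg _))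
      (h.hasSum_sq_integral hab hK hM hsymm measurableSet_Icc hJs)
  have hin : ∀ x ∈ J, (volume J).toReal * (D (t, t) / 2) ≤ ∫ y in J, D (x, y) := by
    intro x hx
    have hint : IntegrableOn (fun y => D (x, y)) J :=
      (hDc.comp (by fun_prop) fun y hy => ⟨hJs hx, hJs hy⟩).integrableOn_compact isCompact_Icc
    have := setIntegral_mono_on (integrableOn_const hJfin) hint measurableSet_Icc (hDlow x hx)
    simpa [Measure.real] using this
  have hge : (volume J).toReal * ((volume J).toReal * (D (t, t) / 2)) ≤
      ∫ x in J, ∫ y in J, D (x, y) := by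
    have hint : IntegrableOn (fun x => ∫ y in J, D (x, y)) J := by
      simp only [hinner]
      exact (integrable_finsetSum _ hsumint).sub hKint
    have := setIntegral_mono_on (integrableOn_const hJfin) hint measurableSet_Icc hin
    simpa [Measure.real] using this
  have : 0 < (volume J).toReal * ((volume J).toReal * (D (t, t) / 2)) := by positivity
  linarith

/-- Tails of the Mercer series are small uniformly in the second variable. -/
theorem abs_sum_mul_le_of_sum_sq_le {F : ℕ → ℝ → ℝ} {u : Finset ℕ} {s t B ε : ℝ} (hε : 0 ≤ ε)
    (hs : ∑ n ∈ u, F n s ^ 2 ≤ ε ^ 2 / (B + 1)) (hB : 0 ≤ B) (ht : ∑ n ∈ u, F n t ^ 2 ≤ B) :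
    |∑ n ∈ u, F n s * F n t| ≤ ε := by
  refine abs_le_of_sq_le_sq ?_ hε
  -- Cauchy–Schwarz; B + 1 replaces B because B may be 0.
  calc (∑ n ∈ u, F n s * F n t) ^ 2 ≤ (∑ n ∈ u, F n s ^ 2) * ∑ n ∈ u, F n t ^ 2 :=
        Finset.sum_mul_sq_le_sq_mul_sq _ _ _
    _ ≤ ε ^ 2 / (B + 1) * B := by
        gcongr
    _ ≤ ε ^ 2 / (B + 1) * (B + 1) := by gcongr; linarith
    _ = ε ^ 2 := by field_simp

/-- If the squares `F n t ^ 2` have bounded sums, uniformly in `t`, then the series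
`∑ F n s * F n t` converges uniformly in `t`. -/
theorem exists_tendstoUniformlyOn_sum_mul {F : ℕ → ℝ → ℝ} {S : Set ℝ} {B : ℝ}
    (hF : ∀ t ∈ S, ∀ u : Finset ℕ, ∑ n ∈ u, F n t ^ 2 ≤ B) {s : ℝ} (hs : s ∈ S) :
    (∀ t ∈ S, Summable fun n => F n s * F n t) ∧
    TendstoUniformlyOn (fun (u : Finset ℕ) t => ∑ n ∈ u, F n s * F n t)
      (fun t => ∑' n, F n s * F n t) atTop S := by
  have hB : 0 ≤ B := by simpa using hF s hs ∅
  have hsq : ∀ t ∈ S, Summable fun n => F n t ^ 2 := fun t ht =>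
    summable_of_sum_le (fun _ => sq_nonneg _) (hF t ht)
  have hsum : ∀ t ∈ S, Summable fun n => F n s * F n t := by
    intro t ht
    refine Summable.of_norm_bounded ((hsq s hs).add (hsq t ht)) fun n => ?_
    rw [Real.norm_eq_abs, abs_le]
    constructor <;> nlinarith [sq_nonneg (F n s + F n t), sq_nonneg (F n s - F n t),
      sq_nonneg (F n s), sq_nonneg (F n t)]
  refine ⟨hsum, ?_⟩
  rw [Metric.tendstoUniformlyOn_iff]
  intro ε hε
  -- Only the tail at the fixed point s has to be small; at t the uniform bound B suffices, hence
  -- uniformity in t.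
  obtain ⟨u₀, hu₀⟩ := summable_iff_vanishing_norm.1 (hsq s hs) ((ε / 2) ^ 2 / (B + 1))
    (by positivity)
  filter_upwards [eventually_ge_atTop u₀] with u hu t ht
  have hle : |(∑' n, F n s * F n t) - ∑ n ∈ u, F n s * F n t| ≤ ε / 2 := by
    have hlim := ((hsum t ht).hasSum.sub_const (∑ n ∈ u, F n s * F n t)).abs
    refine le_of_tendsto hlim ?_
    filter_upwards [eventually_ge_atTop u] with v hv
    rw [← Finset.sum_sdiff hv, add_sub_cancel_right]
    refine abs_sum_mul_le_of_sum_sq_le (by positivity) ?_ hB (hF t ht _)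
    have := hu₀ (v \ u) (Finset.disjoint_left.2 fun x hx hx' =>
      (Finset.mem_sdiff.1 hx).2 (hu hx'))
    exact (le_abs_self _).trans this.le
  rw [Real.dist_eq]
  linarith

/-- Mercer's expansion for bounded continuous kernels on the plane. -/
theorem IsMercerSystem.hasSum_of_continuous (h : IsMercerSystem a b K lam f) (hab : a < b)
    (hK : Continuous (Function.uncurry K)) (hM : ∀ s t, |K s t| ≤ M)
    (hsymm : ∀ s t, K s t = K t s) {s t : ℝ} (hs : s ∈ Set.Icc a b) (ht : t ∈ Set.Icc a b) :
    HasSum (fun n => √(lam n) * f n s * (√(lam n) * f n t)) (K s t) := by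
  set F : ℕ → ℝ → ℝ := fun n t => √(lam n) * f n t with hFdef
  have hF2 : ∀ n s t, F n s * F n t = lam n * f n s * f n t := fun n s t => by
    have := Real.mul_self_sqrt (h.eigenvalue_nonneg n)
    simp only [hFdef]
    linear_combination (f n s * f n t) * this
  have hFc : ∀ n, ContinuousOn (F n) (Set.Icc a b) := by
    intro n
    by_cases hl : lam n = 0
    · simpa [hFdef, hl] using continuousOn_const
    · exact continuousOn_const.mul (h.continuousOn n hl)
  have hbdd : ∀ t ∈ Set.Icc a b, ∀ u : Finset ℕ, ∑ n ∈ u, F n t ^ 2 ≤ M := by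
    intro t ht u
    refine le_trans (le_of_eq (Finset.sum_congr rfl fun n _ => ?_))
      ((h.sum_sq_le hab hK hM hsymm u ht).trans ((le_abs_self _).trans (hM t t)))
    rw [sq, hF2]
    ring
  obtain ⟨hsum, hunif⟩ := exists_tendstoUniformlyOn_sum_mul hbdd hs
  set S : ℝ → ℝ := fun t => ∑' n, F n s * F n t with hS
  have hSc : ContinuousOn S (Set.Icc a b) := hunif.continuousOn
    (Frequently.of_forall fun u => continuousOn_finsetSum _ fun n _ =>
      continuousOn_const.mul (hFc n))
  have hKs : MemLp (fun t => K s t) 2 (volume.restrict (Set.Icc a b)) :=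
    MemLp.of_bound (by fun_prop : Continuous fun t => K s t).aestronglyMeasurable M
      (Eventually.of_forall fun t => hM s t)
  have hSL : MemLp S 2 (volume.restrict (Set.Icc a b)) := by
    obtain ⟨B, hB⟩ := isCompact_Icc.exists_bound_of_continuousOn hSc
    exact MemLp.of_bound (hSc.aestronglyMeasurable measurableSet_Icc) B
      ((ae_restrict_iff' measurableSet_Icc).2 (Eventually.of_forall hB))
  have hL2 := hasSum_integral_smul h.memLp h.orthonormal h.total hKs
  have hcoef : ∀ n, ∫ t in Set.Icc a b, f n t * K s t = lam n * f n s := fun n => by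
    rw [← h.kernelOperator_eq hab hK hM n hs]
    simp only [kernelOperator, mul_comm]
  simp only [hcoef] at hL2
  -- Uniform convergence on a space of finite measure implies L² convergence, with m the square root
  -- of the total mass. Uniqueness of limits gives S = K(s, ·) almost everywhere, and continuity
  -- gives it everywhere.
  have hL2' : HasSum (fun n => (lam n * f n s) • (h.memLp n).toLp (f n)) (hSL.toLp S) := by
    rw [HasSum, Metric.tendsto_nhds]
    intro ε hε
    set m : ℝ := measureUnivNNReal (volume.restrict (Set.Icc a b)) ^ (2 : ENNReal).toReal⁻¹
      with hm
    have hm0 : 0 ≤ m := by positivity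
    filter_upwards [Metric.tendstoUniformlyOn_iff.1 hunif (ε / (2 * (m + 1))) (by positivity)]
      with u hu
    rw [dist_eq_norm]
    refine (Lp.norm_le_of_ae_bound (C := ε / (2 * (m + 1))) (by positivity) ?_).trans_lt ?_
    · filter_upwards [Lp.coeFn_sub (∑ n ∈ u, (lam n * f n s) • (h.memLp n).toLp (f n))
        (hSL.toLp S), coeFn_sum_smul_toLp h.memLp (fun n => lam n * f n s) u, hSL.coeFn_toLp,
        ae_restrict_mem measurableSet_Icc] with x h1 h2 h3 hx
      rw [h1, Pi.sub_apply, h2, h3, ← dist_eq_norm, dist_comm]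
      have := (hu x hx).le
      simpa only [hF2] using this
    · rw [← hm]
      have : m * (ε / (2 * (m + 1))) = ε / 2 * (m / (m + 1)) := by field_simp
      rw [this]
      have : m / (m + 1) ≤ 1 := (div_le_one (by positivity)).2 (by linarith)
      nlinarith
  have heq : S =ᵐ[volume.restrict (Set.Icc a b)] fun t => K s t :=
    (MemLp.toLp_eq_toLp_iff hSL hKs).1 (hL2'.unique hL2)
  have hpt : S t = K s t := Measure.eqOn_Icc_of_ae_eq volume hab.ne heq hSc
    (by fun_prop : Continuous fun t => K s t).continuousOn ht
  rw [← hpt]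
  exact (hsum t ht).hasSum

/-- Mercer's expansion of the kernel, pointwise on the square. -/
theorem IsMercerSystem.hasSum (h : IsMercerSystem a b K lam f) (hab : a < b)
    (hK : IsMercerKernel a b K) {s t : ℝ} (hs : s ∈ Set.Icc a b) (ht : t ∈ Set.Icc a b) :
    HasSum (fun n => √(lam n) * f n s * (√(lam n) * f n t)) (K s t) := by
  -- Composing with the projection onto [a, b] extends K to a bounded continuous kernel on the plane
  -- without changing it on the square.
  set p : ℝ → ℝ := fun x => (Set.projIcc a b hab.le x : ℝ) with hp
  have hpc : Continuous p := continuous_subtype_val.comp continuous_projIcc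
  have hpm : ∀ x, p x ∈ Set.Icc a b := fun x => Subtype.prop _
  have hpe : ∀ x ∈ Set.Icc a b, p x = x := fun x hx => by
    simp [hp, Set.projIcc_of_mem hab.le hx]
  set K' : ℝ → ℝ → ℝ := fun x y => K (p x) (p y) with hK'
  have hK'c : Continuous (Function.uncurry K') :=
    hK.continuousOn.comp_continuous (f := fun q : ℝ × ℝ => (p q.1, p q.2)) (by fun_prop)
      fun q => ⟨hpm _, hpm _⟩
  obtain ⟨M, hM⟩ := (isCompact_Icc.prod isCompact_Icc).exists_bound_of_continuousOn hK.continuousOn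
  have hsys : IsMercerSystem a b K' lam f := by
    refine ⟨h.memLp, h.orthonormal, h.total, fun n => ?_, h.eigenvalue_nonneg, h.continuousOn⟩
    filter_upwards [h.eigen n, ae_restrict_mem measurableSet_Icc] with x hx hxm
    rw [← hx]
    refine setIntegral_congr_fun measurableSet_Icc fun y hy => ?_
    simp only [hK', hpe x hxm, hpe y hy]
  have := hsys.hasSum_of_continuous hab hK'c (fun x y => hM (p x, p y) ⟨hpm _, hpm _⟩)
    (fun x y => hK.symm _ (hpm _) _ (hpm _)) hs ht
  simpa only [hK', hpe s hs, hpe t ht] using this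

end Mercer

end

/-! ### The main theorem -/

theorem mainTheorem9 {H : Type*} [NormedAddCommGroup H] [InnerProductSpace ℂ H] [CompleteSpace H]
    (A : VonNeumannAlgebra H) (φ : A.toStarSubalgebra →ₗ[ℂ] ℂ) (hφ : IsState φ)
    (η : ℕ → A.toStarSubalgebra) (hη : ∀ n, IsStandardSemicircular φ (η n))
    (hfree : AreFree φ η) :
    -- the general representation
    (∀ (a b : ℝ) (K : ℝ → ℝ → ℝ) (lam : ℕ → ℝ) (f : ℕ → ℝ → ℝ), a < b →
      IsMercerKernel a b K → IsMercerSystem a b K lam f →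
      (∀ Y : Set.Icc a b → A.toStarSubalgebra,
        IsSumOfSeries (fun n (t : Set.Icc a b) => √(lam n) * f n t) η Y →
        IsCentredSemicircularProcess φ Y fun s t => ((K s t : ℝ) : ℂ)) ∧
      (IsFaithfulOnGenerated φ η → ∃ Y : Set.Icc a b → A.toStarSubalgebra,
        IsSumOfSeries (fun n (t : Set.Icc a b) => √(lam n) * f n t) η Y)) ∧
    -- the sine series of the free Brownian bridge on `[0, 1]`
    (∀ β : Set.Icc (0 : ℝ) 1 → A.toStarSubalgebra,
      IsSumOfSeries (fun n (t : Set.Icc (0 : ℝ) 1) =>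
        √2 * Real.sin ((n + 1 : ℝ) * Real.pi * t) / ((n + 1 : ℝ) * Real.pi)) η β →
      IsFreeBrownianBridge φ 1 β) ∧
    (IsFaithfulOnGenerated φ η → ∃ β : Set.Icc (0 : ℝ) 1 → A.toStarSubalgebra,
      IsSumOfSeries (fun n (t : Set.Icc (0 : ℝ) 1) =>
        √2 * Real.sin ((n + 1 : ℝ) * Real.pi * t) / ((n + 1 : ℝ) * Real.pi)) η β) := by
  refine ⟨fun a b K lam f hab hK hf => ?_, fun β hβ => ?_, fun hfaith => ?_⟩
  · have hsum : ∀ s t : Set.Icc a b,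
        HasSum (fun n => √(lam n) * f n s * (√(lam n) * f n t)) (K s t) :=
      fun s t => hf.hasSum hab hK s.2 t.2
    -- The diagonal s = t of the kernel expansion is the square summability needed for convergence.
    exact ⟨fun Y hY => hY.isCentredSemicircularProcess hφ hη hfree hsum, fun hfaith =>
      exists_isSumOfSeries hφ hη hfree hfaith fun t => by simpa only [sq] using (hsum t t).summable⟩
  · have := hβ.isCentredSemicircularProcess hφ hη hfree
      (K := fun s t => min (s : ℝ) t - (s : ℝ) * t) fun s t => hasSum_sin_mul_sin s.2 t.2
    simpa only [IsFreeBrownianBridge, div_one] using this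
  · exact exists_isSumOfSeries hφ hη hfree hfaith fun t => by
      simpa only [sq] using (hasSum_sin_mul_sin t.2 t.2).summable
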